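/- Conventions. All algorithms are families indexed by the security parameter $n$. A function family is *efficiently computable* if it is computed by Boolean circuits of size polynomial in $n$. A *polynomial-time quantum algorithm* is a family of quantum circuits on polynomially many qubits, made of polynomially many gates from the universal set {Hadamard, phase, $\pi/8$, CNOT} and, if it has access to an oracle $O:\{0,1\}^a\to\{0,1\}^b$, of query gates $|x\rangle|y\rangle\mapsto|x\rangle|y\oplus O(x)\rangle$. The circuit is run on the classical input with all other qubits $0$, and its output is measured in the computational basis. A function $\epsilon(n)$ is *negligible* if it tends to $0$ faster than $1/p(n)$ for every polynomial $p$. * A *quantum-accessible pseudorandom function* is an efficiently computable family $P_n:\{0,1\}^n\times\{0,1\}^n\to\{0,1\}^n$ such that for every polynomial-time quantum algorithm $D$ with quantum access to an oracle, $\bigl|\Pr_k[D^{P_n(k,\cdot)}(1^n)=1]-\Pr_O[D^{O}(1^n)=1]\bigr|$ is negligible, where the key $k\in\{0,1\}^n$ and the function $O:\{0,1\}^n\to\{0,1\}^n$ are uniform. * An *injective trapdoor function* $\mathcal F=(G_0,f,f^{-1})$ consists of an efficiently computable randomized key generation $G_0(1^n)\to(\mathsf{sk},\mathsf{pk})$ (using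 uniform coins), an efficiently computable $f(\mathsf{pk},\cdot):\{0,1\}^{\ell(n)}\to\{0,1\}^{\ell'(n)}$ and an efficiently computable $f^{-1}$ with $f^{-1}(\mathsf{sk},f(\mathsf{pk},x))=x$ for all $x$ and all generated $(\mathsf{sk},\mathsf{pk})$. It is *quantum-immune* if for every polynomial-time quantum algorithm $A$ (without oracle) the probability that $f(\mathsf{pk},A(\mathsf{pk},y))=y$ is negligible, where $(\mathsf{sk},\mathsf{pk})\leftarrow G_0(1^n)$ and $y=f(\mathsf{pk},x)$ for uniform $x$ (that is, $y$ is uniform in the image of $f(\mathsf{pk},\cdot)$). * For a polynomially bounded $m(n)$, the *Bellare–Rogaway scheme* $\mathcal E=(G,E,D)$ of $\mathcal F$, relative to a random oracle $O:\{0,1\}^{\ell(n)}\to\{0,1\}^{m(n)}$ and for messages in $\{0,1\}^{m(n)}$, is given by $G=G_0$, $E^O(\mathsf{pk},\mu)=(f(\mathsf{pk},r),\,O(r)\oplus \mu)$ for uniform $r\in\{0,1\}^{\ell(n)}$, and $D^O(\mathsf{sk},(y,c))=c\oplus O(f^{-1}(\mathsf{sk},y))$. * $\mathcal E$ is *quantum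 CPA secure* (in the quantum-accessible random oracle model) if for every polynomial-time quantum algorithm $A$ the quantity $|\Pr[b'=b]-\tfrac12|$ is negligible in the following game. $O$ is a uniformly random function and $(\mathsf{sk},\mathsf{pk})\leftarrow G(1^n)$; $A$ gets $\mathsf{pk}$ and makes quantum queries to $O$; it makes one classical challenge query $(\mu_0,\mu_1)$ with $\mu_0,\mu_1\in\{0,1\}^{m(n)}$ (the query register is measured), which is answered, for a uniform bit $b$ and fresh coins, with $E^O(\mathsf{pk},\mu_b)$ (added bitwise to an answer register); it makes further quantum queries to $O$ and finally outputs a bit $b'$. Theorem. If quantum-accessible pseudorandom functions exist and $\mathcal F$ is a quantum-immune injective trapdoor function, then for every polynomially bounded $m$ the Bellare–Rogaway encryption scheme of $\mathcal F$ is quantum CPA secure in the quantum-accessible random oracle model. -/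

import Mathlib

open scoped BigOperators

namespace QROM

/-! ### Bit strings and asymptotics -/

/-- Bit strings of length `k`. -/
abbrev Bits (k : ℕ) : Type := Fin k → Bool

/-- The first `a` bits of a string of length `a + b`. -/
def Bits.left {a b : ℕ} (z : Bits (a + b)) : Bits a := fun i => z (Fin.castAdd b i)

/-- The last `b` bits of a string of length `a + b`. -/
def Bits.right {a b : ℕ} (z : Bits (a + b)) : Bits b := fun i => z (Fin.natAdd a i)

/-- Bitwise exclusive or of two strings of the same length. -/
def Bits.add {k : ℕ} (x y : Bits k) : Bits k := fun i => xor (x i) (y i)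

/-- `s n` is bounded by a polynomial in `n`. -/
def PolyBounded (s : ℕ → ℕ) : Prop := ∃ p : Polynomial ℕ, ∀ n, s n ≤ p.eval n

/-- `ε n` decays faster than the inverse of every polynomial in `n`. -/
def Negligible (ε : ℕ → ℝ) : Prop :=
  Asymptotics.SuperpolynomialDecay Filter.atTop (fun n : ℕ => (n : ℝ)) ε

/-! ### Efficient classical functions: polynomial-size Boolean circuits -/

/-- Boolean circuits on `w` wires with `o` output bits. A gate adds one wire, numbered `w`; at the
end, `o` wires are selected as outputs. -/
inductive BoolCircuit (o : ℕ) : ℕ → Type where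
  | outputs {w : ℕ} (sel : Fin o → Fin w) : BoolCircuit o w
  | const {w : ℕ} (v : Bool) (rest : BoolCircuit o (w + 1)) : BoolCircuit o w
  | nand {w : ℕ} (i j : Fin w) (rest : BoolCircuit o (w + 1)) : BoolCircuit o w

/-- The function computed by a Boolean circuit. -/
def BoolCircuit.eval {o : ℕ} : {w : ℕ} → BoolCircuit o w → Bits w → Bits o
  | _, .outputs sel, x => fun j => x (sel j)
  | w, .const v rest, x => rest.eval (Fin.snoc (α := fun _ : Fin (w + 1) => Bool) x v)
  | w, .nand i j rest, x =>
      rest.eval (Fin.snoc (α := fun _ : Fin (w + 1) => Bool) x (!(x i && x j)))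

/-- The number of gates of a Boolean circuit. -/
def BoolCircuit.size {o : ℕ} : {w : ℕ} → BoolCircuit o w → ℕ
  | _, .outputs _ => 0
  | _, .const _ rest => rest.size + 1
  | _, .nand _ _ rest => rest.size + 1

/-- The family `g` is efficiently computable: it has Boolean circuits of polynomial size, and its
input and output lengths are polynomial. -/
def Efficient {i o : ℕ → ℕ} (g : ∀ n, Bits (i n) → Bits (o n)) : Prop :=
  ∃ C : ∀ n, BoolCircuit (o n) (i n),
    (∀ n x, (C n).eval x = g n x) ∧ PolyBounded (fun n => i n + (C n).size + o n)

/-! ### Quantum circuits with and without oracle gates -/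

/-- A (not necessarily normalized) state `∑ z, ψ z |z⟩` of `k` qubits. -/
abbrev State (k : ℕ) : Type := Bits k → ℂ

/-- The basis state `|z⟩`. -/
def ket {k : ℕ} (z : Bits k) : State k := Pi.single z 1

/-- The exclusive or of the string `s` into the positions `w` of `z`. -/
def xorAt {k : ℕ} {ι : Type} [Fintype ι] (w : ι → Fin k) (s : ι → Bool) (z : Bits k) : Bits k :=
  fun q => xor (z q) (decide (∃ j, w j = q ∧ s j = true))

/-- The string that holds `s` at the positions `w` and zeros elsewhere. -/
def place {k : ℕ} {ι : Type} [Fintype ι] (w : ι → Fin k) (s : ι → Bool) : Bits k :=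
  xorAt w s (fun _ => false)

/-- The unitary `|z⟩ ↦ |z ⊕ s⟩`, with `s` added at the positions `w` (an involution). -/
def State.xorAt {k : ℕ} {ι : Type} [Fintype ι] (w : ι → Fin k) (s : ι → Bool) (ψ : State k) :
    State k :=
  fun z => ψ (QROM.xorAt w s z)

/-- The projection of `ψ` to the basis states that read `s` at the positions `w`: the state after
measuring these qubits with outcome `s`, scaled so that its squared norm is the probability of
this outcome. -/
def State.project {k : ℕ} {ι : Type} [Fintype ι] (w : ι → Fin k) (s : ι → Bool) (ψ : State k) :
    State k :=
  fun z => if (fun j => z (w j)) = s then ψ z else 0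

/-- The probability that measuring `ψ` in the computational basis gives a string in `P`. -/
noncomputable def State.prob {k : ℕ} (ψ : State k) (P : Bits k → Prop) [DecidablePred P] : ℝ :=
  ∑ z, if P z then ‖ψ z‖ ^ 2 else 0

/-- The universal gate set: Hadamard, phase, `π/8` and controlled-not (control, target). -/
inductive Gate (k : ℕ) : Type where
  | hadamard (i : Fin k)
  | phase (i : Fin k)
  | piEighth (i : Fin k)
  | cnot (i j : Fin k) (h : i ≠ j)

/-- The action of a gate on states. -/
noncomputable def Gate.apply {k : ℕ} : Gate k → State k → State k
  | .hadamard i, ψ => fun z =>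
      (ψ (Function.update z i false) + (if z i then -1 else 1) * ψ (Function.update z i true))
        / (Real.sqrt 2 : ℂ)
  | .phase i, ψ => fun z => (if z i then Complex.I else 1) * ψ z
  | .piEighth i, ψ => fun z => (if z i then Complex.exp (Complex.I * Real.pi / 4) else 1) * ψ z
  | .cnot i j _, ψ => fun z => ψ (Function.update z j (xor (z j) (z i)))

/-- Gates on `k` qubits, together with query gates for an oracle from `a` bits to `b` bits. A query
gate names the (pairwise distinct) qubits of the input and of the answer register. -/
inductive OracleGate (k a b : ℕ) : Type where
  | basic (g : Gate k)
  | query (w : Fin a ⊕ Fin b ↪ Fin k)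

/-- The action of a gate when the oracle is `O`; a query maps `|x, y⟩` to `|x, y ⊕ O x⟩`. -/
noncomputable def OracleGate.apply {k a b : ℕ} (O : Bits a → Bits b) :
    OracleGate k a b → State k → State k
  | .basic g, ψ => g.apply ψ
  | .query w, ψ => fun z =>
      ψ (QROM.xorAt (fun j => w (Sum.inr j)) (O fun i => z (w (Sum.inl i))) z)

/-- Runs a circuit (first gate first). -/
noncomputable def run {k : ℕ} (C : List (Gate k)) (ψ : State k) : State k :=
  C.foldl (fun φ g => g.apply φ) ψ

/-- Runs an oracle circuit (first gate first) with the oracle `O`. -/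
noncomputable def runOracle {k a b : ℕ} (O : Bits a → Bits b) (C : List (OracleGate k a b))
    (ψ : State k) : State k :=
  C.foldl (fun φ g => g.apply O φ) ψ

/-- A quantum algorithm (for one value of the security parameter) without oracle, with `i`
classical input bits and `o` output bits: a circuit that is run on the input, written to the qubits
`input`, and zeros in all other qubits; then the qubits `output` are measured. -/
structure QAlg (i o : ℕ) where
  qubits : ℕ
  input : Fin i ↪ Fin qubits
  output : Fin o ↪ Fin qubits
  circuit : List (Gate qubits)

/-- The number of qubits and gates. -/
def QAlg.size {i o : ℕ} (A : QAlg i o) : ℕ := A.qubits + A.circuit.length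

/-- The probability that the output of `A` on input `x` lies in `P`. -/
noncomputable def QAlg.prob {i o : ℕ} (A : QAlg i o) (x : Bits i) (P : Bits o → Prop)
    [DecidablePred P] : ℝ :=
  (run A.circuit (ket (place A.input x))).prob (fun z => P fun j => z (A.output j))

/-! ### Quantum-accessible pseudorandom functions -/

/-- A quantum distinguisher (for one value of the security parameter) with quantum access to a
function from `a` bits to `b` bits. It starts with all qubits zero and outputs one bit. -/
structure Distinguisher (a b : ℕ) where
  qubits : ℕ
  output : Fin qubits
  circuit : List (OracleGate qubits a b)

/-- The number of qubits and gates, oracle queries included. -/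
def Distinguisher.size {a b : ℕ} (D : Distinguisher a b) : ℕ := D.qubits + D.circuit.length

/-- The probability that `D` outputs `1` when its oracle is `O`. -/
noncomputable def Distinguisher.prob {a b : ℕ} (D : Distinguisher a b) (O : Bits a → Bits b) : ℝ :=
  (runOracle O D.circuit (ket fun _ => false)).prob (fun z => z D.output = true)

/-- `F` (key, argument) is a quantum-accessible pseudorandom function, with keys, arguments and
values of length `n` for the security parameter `n`. -/
def IsQuantumPRF (F : ∀ n, Bits n → Bits n → Bits n) : Prop :=
  Efficient (i := fun n => n + n) (o := fun n => n) (fun n z => F n z.left z.right) ∧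
  ∀ D : ∀ n, Distinguisher n n, PolyBounded (fun n => (D n).size) →
    Negligible fun n =>
      |(𝔼 key : Bits n, (D n).prob (F n key)) - 𝔼 O : Bits n → Bits n, (D n).prob O|

/-! ### Injective trapdoor functions -/

/-- An injective trapdoor function: efficient algorithms for key generation (secret key, public
key), evaluation and inversion, where inversion with the secret key recovers the argument (so that
evaluation is injective) for every generated key pair. -/
structure InjectiveTDF where
  (coinLen skLen pkLen domLen rngLen : ℕ → ℕ)
  gen : ∀ n, Bits (coinLen n) → Bits (skLen n) × Bits (pkLen n)
  eval : ∀ n, Bits (pkLen n) → Bits (domLen n) → Bits (rngLen n)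
  inv : ∀ n, Bits (skLen n) → Bits (rngLen n) → Bits (domLen n)
  inv_eval : ∀ n ρ x, inv n (gen n ρ).1 (eval n (gen n ρ).2 x) = x
  gen_efficient : Efficient (i := coinLen) (o := fun n => skLen n + pkLen n)
    (fun n ρ => Fin.append (gen n ρ).1 (gen n ρ).2)
  eval_efficient : Efficient (i := fun n => pkLen n + domLen n) (o := rngLen)
    (fun n z => eval n z.left z.right)
  inv_efficient : Efficient (i := fun n => skLen n + rngLen n) (o := domLen)
    (fun n z => inv n z.left z.right)

/-- The probability that `A`, given a generated public key and a random element `y` of the image of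
`eval n pk`, outputs a preimage of `y`. As `eval n pk` is injective, `y` is sampled as the value at
a uniform argument. -/
noncomputable def InjectiveTDF.invProb (F : InjectiveTDF) (n : ℕ)
    (A : QAlg (F.pkLen n + F.rngLen n) (F.domLen n)) : ℝ :=
  𝔼 ρ : Bits (F.coinLen n), 𝔼 x : Bits (F.domLen n),
    A.prob (Fin.append (F.gen n ρ).2 (F.eval n (F.gen n ρ).2 x))
      (fun x' => F.eval n (F.gen n ρ).2 x' = F.eval n (F.gen n ρ).2 x)

/-- Polynomial-size quantum algorithms (without oracle) invert `F` with negligible probability. -/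
def InjectiveTDF.QuantumImmune (F : InjectiveTDF) : Prop :=
  ∀ A : ∀ n, QAlg (F.pkLen n + F.rngLen n) (F.domLen n), PolyBounded (fun n => (A n).size) →
    Negligible fun n => F.invProb n (A n)

/-! ### Public-key encryption in the quantum-accessible random oracle model -/

/-- A public-key encryption scheme in the random oracle model. Key generation and encryption get
their random coins as an argument. -/
structure ROEncryption where
  (hashIn hashOut genCoins encCoins skLen pkLen msgLen ctLen : ℕ → ℕ)
  gen : ∀ n, Bits (genCoins n) → Bits (skLen n) × Bits (pkLen n)
  enc : ∀ n, (Bits (hashIn n) → Bits (hashOut n)) → Bits (pkLen n) → Bits (msgLen n) →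
    Bits (encCoins n) → Bits (ctLen n)
  dec : ∀ n, (Bits (hashIn n) → Bits (hashOut n)) → Bits (skLen n) → Bits (ctLen n) →
    Bits (msgLen n)
  correct : ∀ n O ρ msg r, dec n O (gen n ρ).1 (enc n O (gen n ρ).2 msg r) = msg

/-- A quantum chosen-plaintext adversary (for one value of the security parameter) with oracle
length parameters `a`, `b`, and public keys, messages and ciphertexts of lengths `pk`, `msg`, `ct`.
It starts with the public key in the qubits `input` and zeros elsewhere, runs `before`, makes its
classical challenge query through the qubits `challenge` (two messages, and an answer register for
the ciphertext), runs `after`, and outputs the bit measured at `output`. -/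
structure CPAAdversary (a b pk msg ct : ℕ) where
  qubits : ℕ
  input : Fin pk ↪ Fin qubits
  challenge : (Fin msg ⊕ Fin msg) ⊕ Fin ct ↪ Fin qubits
  output : Fin qubits
  before : List (OracleGate qubits a b)
  after : List (OracleGate qubits a b)

/-- The number of qubits and gates, oracle queries included. -/
def CPAAdversary.size {a b pk msg ct : ℕ} (A : CPAAdversary a b pk msg ct) : ℕ :=
  A.qubits + A.before.length + A.after.length

/-- The probability that `A` outputs `bit`, when its input is `key`, the random oracle is `O`, and
the challenge query `m₀, m₁` is answered by `answer m₀ m₁`. The two messages are measured; then the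
answer is added to the answer register. -/
noncomputable def CPAAdversary.prob {a b pk msg ct : ℕ} (A : CPAAdversary a b pk msg ct)
    (O : Bits a → Bits b) (key : Bits pk) (answer : Bits msg → Bits msg → Bits ct)
    (bit : Bool) : ℝ :=
  ∑ m₀ : Bits msg, ∑ m₁ : Bits msg,
    (runOracle O A.after
      (State.xorAt (fun j => A.challenge (Sum.inr j)) (answer m₀ m₁)
        (State.project (fun j => A.challenge (Sum.inl j)) (Sum.elim m₀ m₁)
          (runOracle O A.before (ket (place A.input key)))))).prob
      (fun z => z A.output = bit)

/-- The probability that `A` wins the chosen-plaintext game: over a uniform random oracle, a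
generated key pair, a uniform bit and the coins of the challenge encryption, the output of `A` is
the bit that selects the encrypted message. -/
noncomputable def ROEncryption.cpaProb (E : ROEncryption) (n : ℕ)
    (A : CPAAdversary (E.hashIn n) (E.hashOut n) (E.pkLen n) (E.msgLen n) (E.ctLen n)) : ℝ :=
  𝔼 O : Bits (E.hashIn n) → Bits (E.hashOut n), 𝔼 ρ : Bits (E.genCoins n), 𝔼 bit : Bool,
    𝔼 r : Bits (E.encCoins n),
      A.prob O (E.gen n ρ).2
        (fun m₀ m₁ => E.enc n O (E.gen n ρ).2 (if bit then m₁ else m₀) r) bit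

/-- Chosen-plaintext security in the quantum-accessible random oracle model: the advantage of every
family of polynomial-size quantum adversaries is negligible. -/
def ROEncryption.QuantumCPASecure (E : ROEncryption) : Prop :=
  ∀ A : ∀ n, CPAAdversary (E.hashIn n) (E.hashOut n) (E.pkLen n) (E.msgLen n) (E.ctLen n),
    PolyBounded (fun n => (A n).size) → Negligible fun n => |E.cpaProb n (A n) - 1 / 2|

/-- The Bellare–Rogaway encryption scheme with messages of length `m n`, for a random oracle from
the domain of `F` to strings of length `m n`: the public key `pk` encrypts `msg` with coins `r` as
`(f(pk, r), O(r) ⊕ msg)`, and `(y, c)` is decrypted to `c ⊕ O(f⁻¹(sk, y))`. -/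
def InjectiveTDF.bellareRogaway (F : InjectiveTDF) (m : ℕ → ℕ) : ROEncryption where
  hashIn := F.domLen
  hashOut := m
  genCoins := F.coinLen
  encCoins := F.domLen
  skLen := F.skLen
  pkLen := F.pkLen
  msgLen := m
  ctLen := fun n => F.rngLen n + m n
  gen := F.gen
  enc := fun n O pk msg r => Fin.append (F.eval n pk r) ((O r).add msg)
  dec := fun n O sk c => c.right.add (O (F.inv n sk c.left))
  correct := by
    intro n O ρ msg r
    have hl : Bits.left (Fin.append (F.eval n (F.gen n ρ).2 r) ((O r).add msg)) =
        F.eval n (F.gen n ρ).2 r := by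
      funext i; simp [Bits.left]
    funext i
    rw [hl, F.inv_eval]
    simp only [Bits.add, Bits.right, Fin.append_right]
    cases O r i <;> cases msg i <;> rfl

end QROM

/-!
The ciphertext `(f(pk, x), O(x) ⊕ μ_b)` hides the bit `b` unless the adversary queries the oracle
`O` at `x`. To make this precise, the mask `O(x)` is written as an independent uniform string `z`,
at the price of reprogramming `O` to take the value `z` at `x` (`expect_eq_expect_update`). If the
oracle is not reprogrammed, the mask is independent of everything else and `b` is guessed with
probability exactly one half (`expect_prob_independent_mask`). The two games are compared by the
one-way-to-hiding bound `abs_prob_runOracle_sub_le`: their winning probabilities differ by at most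
four times the sum, over all gates, of the square roots of the probabilities that measuring the
query yields `x`. For this the adversary is turned into a single oracle circuit, which copies the
challenge messages to fresh qubits instead of measuring them (`prob_coreCircuit`).

Measuring a query of the unreprogrammed game inverts the trapdoor function, except that the
inverter has no random oracle. It uses the pseudorandom function instead, at a security parameter
`N n` that exceeds the lengths involved, with padded arguments and truncated values
(`truncOracle`). Its Boolean circuit is evaluated reversibly by Toffoli gates, which are built
from the universal gates, and uncomputed (`BoolCircuit.exists_classicalCircuit`,
`exists_inverter`). That the probability of finding `x` hardly changes is pseudorandomness,
applied to a distinguisher that simulates the adversary and tests whether the query is equal to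
`x` (`exists_distinguisher`).

As circuit families are nonuniform, all choices that the reduction would make at random are
hardwired to the best possible ones (`exists_reduction`). This includes the key of the
pseudorandom function for the inverter, and the coins of the key generation and the argument `x`
for the distinguisher. The conclusion is an inequality for each `n` between the advantage of the
adversary and `4 * L * √(inversion probability + distinguishing advantage)`, with a polynomial
bound `L` on the number of gates.
-/

namespace QROM

/-! ### Adding strings into registers -/

theorem xorAt_apply {k : ℕ} {ι : Type} [Fintype ι] {w : ι → Fin k} (hw : Function.Injective w)
    (s : ι → Bool) (z : Bits k) (j : ι) : xorAt w s z (w j) = xor (z (w j)) (s j) := by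
  have h : (∃ i, w i = w j ∧ s i = true) ↔ s j = true :=
    ⟨fun ⟨i, hi, hs⟩ => hw hi ▸ hs, fun hs => ⟨j, rfl, hs⟩⟩
  simp [xorAt, h]

theorem xorAt_apply_of_ne {k : ℕ} {ι : Type} [Fintype ι] {w : ι → Fin k} (s : ι → Bool)
    (z : Bits k) {q : Fin k} (hq : ∀ j, w j ≠ q) : xorAt w s z q = z q := by
  simp [xorAt, hq]

theorem xorAt_xorAt {k : ℕ} {ι : Type} [Fintype ι] (w : ι → Fin k) (s : ι → Bool) (z : Bits k) :
    xorAt w s (xorAt w s z) = z := by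
  funext q
  simp [xorAt]

/-- The map on basis states that a query gate for the oracle `O` induces. -/
def queryMap {k a b : ℕ} (O : Bits a → Bits b) (w : Fin a ⊕ Fin b ↪ Fin k) (z : Bits k) : Bits k :=
  xorAt (fun j => w (Sum.inr j)) (O fun i => z (w (Sum.inl i))) z

theorem queryMap_inl {k a b : ℕ} (O : Bits a → Bits b) (w : Fin a ⊕ Fin b ↪ Fin k) (z : Bits k)
    (i : Fin a) : queryMap O w z (w (Sum.inl i)) = z (w (Sum.inl i)) :=
  xorAt_apply_of_ne _ _ fun _ h => by simpa using w.injective h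

theorem queryMap_queryMap {k a b : ℕ} (O : Bits a → Bits b) (w : Fin a ⊕ Fin b ↪ Fin k)
    (z : Bits k) : queryMap O w (queryMap O w z) = z := by
  have h : (fun i => queryMap O w z (w (Sum.inl i))) = fun i => z (w (Sum.inl i)) :=
    funext fun i => queryMap_inl O w z i
  rw [queryMap, h]
  exact xorAt_xorAt _ _ _

theorem OracleGate.apply_query {k a b : ℕ} (O : Bits a → Bits b) (w : Fin a ⊕ Fin b ↪ Fin k)
    (ψ : State k) : (OracleGate.query w).apply O ψ = fun z => ψ (queryMap O w z) := rfl

/-! ### Basis states and linearity -/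

theorem ket_apply {k : ℕ} (z z' : Bits k) : ket z z' = if z' = z then 1 else 0 := by
  simp [ket, Pi.single_apply]

theorem ket_comp_involution {k : ℕ} {σ : Bits k → Bits k} (h : ∀ z, σ (σ z) = z) (z : Bits k) :
    (fun z' => ket z (σ z')) = ket (σ z) := by
  funext z'
  have : σ z' = z ↔ z' = σ z := ⟨fun e => by rw [← e, h], fun e => by rw [e, h]⟩
  simp only [ket_apply, this]

theorem state_eq_sum {k : ℕ} (ψ : State k) : ψ = ∑ z, ψ z • ket z := by
  funext z'
  simp [Finset.sum_apply, ket_apply]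

theorem IsLinearMap.eq_sum_ket {k K : ℕ} {f : State k → State K} (hf : IsLinearMap ℂ f)
    (ψ : State k) : f ψ = ∑ z, ψ z • f (ket z) := by
  conv_lhs => rw [state_eq_sum ψ]
  rw [← hf.mk'_apply, map_sum]
  simp

theorem IsLinearMap.eq_of_ket {k K : ℕ} {f g : State k → State K} (hf : IsLinearMap ℂ f)
    (hg : IsLinearMap ℂ g) (h : ∀ z, f (ket z) = g (ket z)) (ψ : State k) : f ψ = g ψ := by
  rw [IsLinearMap.eq_sum_ket hf, IsLinearMap.eq_sum_ket hg]
  simp [h]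

theorem IsLinearMap.comp' {k K L : ℕ} {g : State K → State L} {f : State k → State K}
    (hg : IsLinearMap ℂ g) (hf : IsLinearMap ℂ f) : IsLinearMap ℂ fun ψ => g (f ψ) :=
  ⟨fun x y => by rw [hf.map_add, hg.map_add], fun c x => by rw [hf.map_smul, hg.map_smul]⟩

theorem isLinearMap_comp {k K : ℕ} (σ : Bits K → Bits k) :
    IsLinearMap ℂ fun (ψ : State k) (z : Bits K) => ψ (σ z) :=
  ⟨fun _ _ => rfl, fun _ _ => rfl⟩

theorem Gate.isLinearMap {k : ℕ} (g : Gate k) : IsLinearMap ℂ g.apply := by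
  constructor
  · intro x y
    cases g <;> funext z <;> simp only [Gate.apply, Pi.add_apply] <;> ring
  · intro c x
    cases g <;> funext z <;> simp only [Gate.apply, Pi.smul_apply, smul_eq_mul] <;> ring

theorem OracleGate.isLinearMap {k a b : ℕ} (O : Bits a → Bits b) (g : OracleGate k a b) :
    IsLinearMap ℂ (g.apply O) := by
  cases g with
  | basic g => exact g.isLinearMap
  | query w => exact isLinearMap_comp _

theorem isLinearMap_foldl {k : ℕ} {α : Type} {act : α → State k → State k}
    (h : ∀ g, IsLinearMap ℂ (act g)) (C : List α) :
    IsLinearMap ℂ fun ψ => C.foldl (fun φ g => act g φ) ψ := by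
  induction C with
  | nil => exact ⟨fun _ _ => rfl, fun _ _ => rfl⟩
  | cons g C ih => exact IsLinearMap.comp' ih (h g)

theorem run_isLinearMap {k : ℕ} (C : List (Gate k)) : IsLinearMap ℂ (run C) :=
  isLinearMap_foldl (act := Gate.apply) Gate.isLinearMap C

theorem runOracle_isLinearMap {k a b : ℕ} (O : Bits a → Bits b) (C : List (OracleGate k a b)) :
    IsLinearMap ℂ (runOracle O C) :=
  isLinearMap_foldl (act := OracleGate.apply O) (OracleGate.isLinearMap O) C

theorem run_append {k : ℕ} (C D : List (Gate k)) (ψ : State k) :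
    run (C ++ D) ψ = run D (run C ψ) := List.foldl_append

theorem runOracle_append {k a b : ℕ} (O : Bits a → Bits b) (C D : List (OracleGate k a b))
    (ψ : State k) : runOracle O (C ++ D) ψ = runOracle O D (runOracle O C ψ) := List.foldl_append

theorem run_cons {k : ℕ} (g : Gate k) (D : List (Gate k)) (ψ : State k) :
    run (g :: D) ψ = run D (g.apply ψ) := rfl

theorem runOracle_cons {k a b : ℕ} (O : Bits a → Bits b) (g : OracleGate k a b)
    (D : List (OracleGate k a b)) (ψ : State k) :
    runOracle O (g :: D) ψ = runOracle O D (g.apply O ψ) := rfl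

theorem runOracle_basic {k a b : ℕ} (O : Bits a → Bits b) (C : List (Gate k)) (ψ : State k) :
    runOracle O (C.map OracleGate.basic) ψ = run C ψ := by
  induction C generalizing ψ with
  | nil => rfl
  | cons g C ih => exact ih _

theorem OracleGate.apply_query_ket {k a b : ℕ} (O : Bits a → Bits b) (w : Fin a ⊕ Fin b ↪ Fin k)
    (z : Bits k) : (OracleGate.query w).apply O (ket z) = ket (queryMap O w z) :=
  ket_comp_involution (queryMap_queryMap O w) z

/-! ### The norm of a state -/

/-- The squared `ℓ²` norm of a state. -/
noncomputable def State.normSq {k : ℕ} (ψ : State k) : ℝ := ∑ z, ‖ψ z‖ ^ 2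

/-- The `ℓ²` norm of a state. -/
noncomputable def State.norm {k : ℕ} (ψ : State k) : ℝ := Real.sqrt ψ.normSq

theorem State.norm_eq {k : ℕ} (ψ : State k) : ψ.norm = ‖WithLp.toLp 2 ψ‖ := by
  rw [EuclideanSpace.norm_eq]; rfl

theorem State.norm_nonneg {k : ℕ} (ψ : State k) : 0 ≤ ψ.norm := Real.sqrt_nonneg _

theorem State.norm_add_le {k : ℕ} (ψ φ : State k) : (ψ + φ).norm ≤ ψ.norm + φ.norm := by
  simp only [State.norm_eq, WithLp.toLp_add]
  exact _root_.norm_add_le _ _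

theorem State.norm_neg {k : ℕ} (ψ : State k) : (-ψ).norm = ψ.norm := by
  simp [State.norm, State.normSq]

theorem State.norm_sub_le {k : ℕ} (ψ φ : State k) : (ψ - φ).norm ≤ ψ.norm + φ.norm := by
  rw [sub_eq_add_neg, ← State.norm_neg φ]
  exact State.norm_add_le _ _

theorem State.abs_norm_sub_norm_le {k : ℕ} (ψ φ : State k) :
    |ψ.norm - φ.norm| ≤ (ψ - φ).norm := by
  simp only [State.norm_eq, WithLp.toLp_sub]
  exact _root_.abs_norm_sub_norm_le _ _

theorem normSq_ket {k : ℕ} (z : Bits k) : (ket z).normSq = 1 := by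
  simp [State.normSq, ket_apply, apply_ite]

theorem State.normSq_comp_involution {k : ℕ} {σ : Bits k → Bits k} (h : ∀ z, σ (σ z) = z)
    (ψ : State k) : State.normSq (fun z => ψ (σ z)) = ψ.normSq :=
  Equiv.sum_comp (Function.Involutive.toPerm σ h) fun z => ‖ψ z‖ ^ 2

theorem update_flip_flip {k : ℕ} (i : Fin k) (z : Bits k) :
    Function.update (Function.update z i (!z i)) i (!(Function.update z i (!z i)) i) = z := by
  simp

theorem Gate.normSq_apply {k : ℕ} (g : Gate k) (ψ : State k) : (g.apply ψ).normSq = ψ.normSq := by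
  cases g with
  | hadamard i =>
    -- Pair every basis state with the one that differs at `i`, and use the parallelogram law.
    have flip : ∀ f : Bits k → ℝ, ∑ z, f z = ∑ z, f (Function.update z i (!z i)) := fun f =>
      (Equiv.sum_comp (Function.Involutive.toPerm
        (fun z : Bits k => Function.update z i (!z i)) (update_flip_flip i)) f).symm
    have key : ∀ z : Bits k, ‖(Gate.hadamard i).apply ψ z‖ ^ 2
          + ‖(Gate.hadamard i).apply ψ (Function.update z i (!z i))‖ ^ 2
        = ‖ψ z‖ ^ 2 + ‖ψ (Function.update z i (!z i))‖ ^ 2 := by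
      intro z
      have par : ∀ a b : ℂ, ‖(a + b) / (Real.sqrt 2 : ℂ)‖ ^ 2
          + ‖(a + -1 * b) / (Real.sqrt 2 : ℂ)‖ ^ 2 = ‖a‖ ^ 2 + ‖b‖ ^ 2 := by
        intro a b
        have h2 : ‖(Real.sqrt 2 : ℂ)‖ ^ 2 = 2 := by
          rw [Complex.norm_real, Real.norm_eq_abs, sq_abs, Real.sq_sqrt (by norm_num)]
        have := parallelogram_law_with_norm ℝ a b
        rw [norm_div, norm_div, div_pow, div_pow, h2, neg_one_mul, ← sub_eq_add_neg]
        linarith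
      cases hz : z i
      · have e : Function.update z i false = z := by rw [← hz]; exact Function.update_eq_self i z
        simp only [Gate.apply, hz, Function.update_idem, Function.update_self, Bool.not_false, e,
          if_true, Bool.false_eq_true, if_false, one_mul]
        exact par _ _
      · have e : Function.update z i true = z := by rw [← hz]; exact Function.update_eq_self i z
        simp only [Gate.apply, hz, Function.update_idem, Function.update_self, Bool.not_true, e,
          if_true, Bool.false_eq_true, if_false, one_mul]
        rw [add_comm, par, add_comm]
    have h1 := flip fun z => ‖(Gate.hadamard i).apply ψ z‖ ^ 2
    have h2 := flip fun z => ‖ψ z‖ ^ 2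
    have h3 := Finset.sum_congr (rfl : (Finset.univ : Finset (Bits k)) = _) fun z _ => key z
    rw [Finset.sum_add_distrib, Finset.sum_add_distrib, ← h1, ← h2] at h3
    simp only [State.normSq]
    linarith
  | phase i =>
    refine Finset.sum_congr rfl fun z _ => ?_
    cases h : z i <;> simp [Gate.apply, h]
  | piEighth i =>
    refine Finset.sum_congr rfl fun z _ => ?_
    have : ‖Complex.exp (Complex.I * Real.pi / 4)‖ = 1 := by
      have := Complex.norm_exp_ofReal_mul_I (Real.pi / 4)
      rw [← this]; congr 2; push_cast; ring
    cases h : z i <;> simp [Gate.apply, h, this]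
  | cnot i j h =>
    refine State.normSq_comp_involution (σ := fun z => Function.update z j (xor (z j) (z i)))
      (fun z => ?_) ψ
    simp [Function.update_of_ne h]

theorem OracleGate.normSq_apply {k a b : ℕ} (O : Bits a → Bits b) (g : OracleGate k a b)
    (ψ : State k) : (g.apply O ψ).normSq = ψ.normSq := by
  cases g with
  | basic g => exact g.normSq_apply ψ
  | query w => exact State.normSq_comp_involution (queryMap_queryMap O w) ψ

theorem normSq_runOracle {k a b : ℕ} (O : Bits a → Bits b) (C : List (OracleGate k a b))
    (ψ : State k) : (runOracle O C ψ).normSq = ψ.normSq := by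
  induction C generalizing ψ with
  | nil => rfl
  | cons g C ih => rw [runOracle_cons, ih, OracleGate.normSq_apply]

/-! ### Circuits on part of the qubits -/

/-- A string at the positions `e`, on the background `β`. -/
noncomputable def overlay {k K : ℕ} (e : Fin k ↪ Fin K) (β : Bits K) (z : Bits k) : Bits K :=
  Function.extend e z β

theorem overlay_apply {k K : ℕ} (e : Fin k ↪ Fin K) (β : Bits K) (z : Bits k) (j : Fin k) :
    overlay e β z (e j) = z j := e.injective.extend_apply _ _ _

theorem overlay_of_ne {k K : ℕ} (e : Fin k ↪ Fin K) (β : Bits K) (z : Bits k) {q : Fin K}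
    (hq : ∀ j, e j ≠ q) : overlay e β z q = β q :=
  Function.extend_apply' _ _ _ fun ⟨j, h⟩ => hq j h

theorem overlay_injective {k K : ℕ} (e : Fin k ↪ Fin K) (β : Bits K) :
    Function.Injective (overlay e β) := fun z z' h => by
  funext j
  rw [← overlay_apply e β z j, h, overlay_apply]

theorem overlay_xorAt {k K : ℕ} {ι : Type} [Fintype ι] (e : Fin k ↪ Fin K) (β : Bits K)
    (w : ι → Fin k) (s : ι → Bool) (z : Bits k) :
    overlay e β (xorAt w s z) = xorAt (fun i => e (w i)) s (overlay e β z) := by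
  funext q
  by_cases hq : ∃ j, e j = q
  · obtain ⟨j, rfl⟩ := hq
    simp [overlay_apply, xorAt]
  · push Not at hq
    rw [overlay_of_ne _ _ _ hq, xorAt_apply_of_ne _ _ fun i => hq _, overlay_of_ne _ _ _ hq]

open Classical in
/-- The state `ψ` on the qubits `e`, with the basis state `β` on the other qubits. -/
noncomputable def State.lift {k K : ℕ} (e : Fin k ↪ Fin K) (β : Bits K) (ψ : State k) : State K :=
  fun Z => if ∀ q, (∀ j, e j ≠ q) → Z q = β q then ψ fun j => Z (e j) else 0

theorem lift_isLinearMap {k K : ℕ} (e : Fin k ↪ Fin K) (β : Bits K) :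
    IsLinearMap ℂ (State.lift e β) := by
  constructor
  · intro x y; funext Z; simp only [State.lift, Pi.add_apply]; split_ifs <;> simp
  · intro c x; funext Z; simp only [State.lift, Pi.smul_apply]; split_ifs <;> simp

theorem lift_ket {k K : ℕ} (e : Fin k ↪ Fin K) (β : Bits K) (z : Bits k) :
    State.lift e β (ket z) = ket (overlay e β z) := by
  funext Z
  simp only [State.lift, ket_apply]
  rw [← ite_and]
  congr 1
  refine propext ⟨fun ⟨h1, h2⟩ => ?_, fun h => ⟨fun q hq => ?_, ?_⟩⟩
  · funext q
    by_cases hq : ∃ j, e j = q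
    · obtain ⟨j, rfl⟩ := hq
      rw [overlay_apply, ← h2]
    · push Not at hq
      rw [overlay_of_ne _ _ _ hq, h1 q hq]
  · rw [h, overlay_of_ne _ _ _ hq]
  · funext j; rw [h, overlay_apply]

theorem lift_eq_sum {k K : ℕ} (e : Fin k ↪ Fin K) (β : Bits K) (ψ : State k) :
    State.lift e β ψ = ∑ z, ψ z • ket (overlay e β z) := by
  rw [IsLinearMap.eq_sum_ket (lift_isLinearMap e β)]
  simp only [lift_ket]

/-- The same gate on the images of its qubits. -/
def Gate.map {k K : ℕ} (e : Fin k ↪ Fin K) : Gate k → Gate K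
  | .hadamard i => .hadamard (e i)
  | .phase i => .phase (e i)
  | .piEighth i => .piEighth (e i)
  | .cnot i j h => .cnot (e i) (e j) fun h' => h (e.injective h')

theorem lift_update {k K : ℕ} (e : Fin k ↪ Fin K) (β : Bits K) (ψ : State k) (Z : Bits K)
    (i : Fin k) (v : Bool) : State.lift e β ψ (Function.update Z (e i) v) =
      State.lift e β (fun z => ψ (Function.update z i v)) Z := by
  have h1 : (fun j => Function.update Z (e i) v (e j)) = Function.update (fun j => Z (e j)) i v :=
    Function.update_comp_eq_of_injective Z e.injective i v
  have h2 : (∀ q, (∀ j, e j ≠ q) → Function.update Z (e i) v q = β q) ↔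
      ∀ q, (∀ j, e j ≠ q) → Z q = β q :=
    forall₂_congr fun q hq => by rw [Function.update_of_ne (hq i).symm]
  simp only [State.lift, h1, h2]

theorem Gate.apply_map {k K : ℕ} (e : Fin k ↪ Fin K) (β : Bits K) (g : Gate k) (ψ : State k) :
    (g.map e).apply (State.lift e β ψ) = State.lift e β (g.apply ψ) := by
  cases g <;> funext Z <;> simp only [Gate.map, Gate.apply, lift_update] <;>
    simp only [State.lift] <;> split_ifs <;> simp

theorem lift_xorAt {k K : ℕ} {ι : Type} [Fintype ι] (e : Fin k ↪ Fin K) (β : Bits K) (ψ : State k)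
    (w : ι → Fin k) (s : ι → Bool) (Z : Bits K) :
    State.lift e β ψ (xorAt (fun i => e (w i)) s Z) =
      State.lift e β (fun z => ψ (xorAt w s z)) Z := by
  have h1 : (fun j => xorAt (fun i => e (w i)) s Z (e j)) = xorAt w s (fun j => Z (e j)) := by
    funext j; simp [xorAt]
  have h2 : (∀ q, (∀ j, e j ≠ q) → xorAt (fun i => e (w i)) s Z q = β q) ↔
      ∀ q, (∀ j, e j ≠ q) → Z q = β q :=
    forall₂_congr fun q hq => by rw [xorAt_apply_of_ne _ _ fun i => hq _]
  simp only [State.lift, h1, h2]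

/-- The same gate, or query, on the images of its qubits. -/
def OracleGate.map {k K a b : ℕ} (e : Fin k ↪ Fin K) : OracleGate k a b → OracleGate K a b
  | .basic g => .basic (g.map e)
  | .query w => .query (w.trans e)

theorem OracleGate.apply_map {k K a b : ℕ} (O : Bits a → Bits b) (e : Fin k ↪ Fin K) (β : Bits K)
    (g : OracleGate k a b) (ψ : State k) :
    (g.map e).apply O (State.lift e β ψ) = State.lift e β (g.apply O ψ) := by
  cases g with
  | basic g => exact g.apply_map e β ψ
  | query w =>
    funext Z
    exact lift_xorAt e β ψ (fun j => w (Sum.inr j)) _ Z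

theorem runOracle_map {k K a b : ℕ} (O : Bits a → Bits b) (e : Fin k ↪ Fin K) (β : Bits K)
    (C : List (OracleGate k a b)) (ψ : State k) :
    runOracle O (C.map (OracleGate.map e)) (State.lift e β ψ) =
      State.lift e β (runOracle O C ψ) := by
  induction C generalizing ψ with
  | nil => rfl
  | cons g C ih => rw [List.map_cons, runOracle_cons, OracleGate.apply_map, ih, runOracle_cons]

/-- Replaces the query gates of a circuit on the qubits `e` by circuits that simulate them. The type
`α` of the gates of the result is left open: plain gates, or gates for another oracle. -/
def substQueries {k K a b : ℕ} {α : Type} (e : Fin k ↪ Fin K) (basic : Gate K → α)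
    (sim : (Fin a ⊕ Fin b ↪ Fin k) → List α) (C : List (OracleGate k a b)) : List α :=
  C.flatMap fun
    | .basic g => [basic (g.map e)]
    | .query w => sim w

/-- Correctness of a simulation needs to be checked on basis states only, by linearity: if each
simulating circuit acts on basis states with the background `β` as a query to `O`, then the
substituted circuit acts on all states with the background `β` as the original one. -/
theorem foldl_substQueries {k K a b : ℕ} {α : Type} {act : α → State K → State K}
    (hact : ∀ g, IsLinearMap ℂ (act g)) {basic : Gate K → α} (hbasic : ∀ g, act (basic g) = g.apply)
    (O : Bits a → Bits b) (e : Fin k ↪ Fin K) (β : Bits K)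
    {sim : (Fin a ⊕ Fin b ↪ Fin k) → List α}
    (hsim : ∀ w z, (sim w).foldl (fun φ g => act g φ) (ket (overlay e β z)) =
      ket (overlay e β (queryMap O w z)))
    (C : List (OracleGate k a b)) (ψ : State k) :
    (substQueries e basic sim C).foldl (fun φ g => act g φ) (State.lift e β ψ) =
      State.lift e β (runOracle O C ψ) := by
  induction C generalizing ψ with
  | nil => rfl
  | cons g C ih =>
    rw [substQueries, List.flatMap_cons, List.foldl_append, runOracle_cons, ← ih]
    congr 1
    cases g with
    | basic g => simp only [List.foldl_cons, List.foldl_nil, hbasic]; exact g.apply_map e β ψ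
    | query w =>
      refine IsLinearMap.eq_of_ket
        (IsLinearMap.comp' (isLinearMap_foldl hact (sim w)) (lift_isLinearMap e β))
        (IsLinearMap.comp' (lift_isLinearMap e β)
          (OracleGate.isLinearMap O (OracleGate.query w))) (fun z => ?_) ψ
      rw [lift_ket, hsim, OracleGate.apply_query_ket, lift_ket]

theorem length_substQueries {k K a b : ℕ} {α : Type} (e : Fin k ↪ Fin K) (basic : Gate K → α)
    (sim : (Fin a ⊕ Fin b ↪ Fin k) → List α) (C : List (OracleGate k a b)) {B : ℕ}
    (hB : ∀ w, (sim w).length ≤ B) :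
    (substQueries e basic sim C).length ≤ C.length * (B + 1) := by
  induction C with
  | nil => simp [substQueries]
  | cons g C ih =>
    rw [substQueries, List.flatMap_cons, List.length_append, List.length_cons, add_mul, one_mul,
      add_comm]
    refine Nat.add_le_add ih ?_
    cases g with
    | basic g => simp
    | query w => exact (hB w).trans (Nat.le_succ _)

/-! ### Measurement probabilities -/

theorem State.prob_nonneg {k : ℕ} (ψ : State k) (P : Bits k → Prop) [DecidablePred P] :
    0 ≤ ψ.prob P := Finset.sum_nonneg fun z _ => by split_ifs <;> positivity

/-- Moving the basis states along an injection `τ` moves the measurement probabilities along. -/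
theorem prob_sum_smul_ket {k K : ℕ} {τ : Bits k → Bits K} (hτ : Function.Injective τ)
    (ψ : State k) (P : Bits K → Prop) [DecidablePred P] :
    State.prob (∑ z, ψ z • ket (τ z)) P = ψ.prob fun z => P (τ z) := by
  have hin : ∀ z, (∑ z', ψ z' • ket (τ z')) (τ z) = ψ z := by
    intro z
    simp [Finset.sum_apply, ket_apply, hτ.eq_iff]
  have hout : ∀ Z, Z ∉ Finset.univ.image τ → (∑ z', ψ z' • ket (τ z')) Z = 0 := by
    intro Z hZ
    rw [Finset.sum_apply]
    refine Finset.sum_eq_zero fun z _ => ?_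
    have : Z ≠ τ z := fun h => hZ (by rw [h]; exact Finset.mem_image_of_mem _ (Finset.mem_univ _))
    simp [ket_apply, this]
  rw [State.prob, State.prob, ← Finset.sum_subset (Finset.subset_univ (Finset.univ.image τ)),
    Finset.sum_image fun _ _ _ _ h => hτ h]
  · simp only [hin]
  · intro Z _ hZ
    simp [hout Z hZ]

theorem prob_lift {k K : ℕ} (e : Fin k ↪ Fin K) (β : Bits K) (ψ : State k) (P : Bits K → Prop)
    [DecidablePred P] : (State.lift e β ψ).prob P = ψ.prob fun z => P (overlay e β z) := by
  rw [lift_eq_sum, prob_sum_smul_ket (overlay_injective e β)]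

/-! ### Diagonal circuits and the Toffoli gate -/

/-- The circuit `L` multiplies each basis state `|z⟩` by `d z`. -/
def IsDiagonal {k : ℕ} (L : List (Gate k)) (d : Bits k → ℂ) : Prop :=
  ∀ ψ, run L ψ = fun z => d z * ψ z

theorem IsDiagonal.append {k : ℕ} {L M : List (Gate k)} {d e : Bits k → ℂ} (hL : IsDiagonal L d)
    (hM : IsDiagonal M e) : IsDiagonal (L ++ M) fun z => e z * d z := fun ψ => by
  rw [run_append, hL, hM]
  simp only [mul_assoc]

theorem IsDiagonal.conj_cnot {k : ℕ} {L : List (Gate k)} {d : Bits k → ℂ} (hL : IsDiagonal L d)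
    {i j : Fin k} (h : i ≠ j) : IsDiagonal (Gate.cnot i j h :: (L ++ [Gate.cnot i j h]))
      fun z => d (Function.update z j (xor (z j) (z i))) := fun ψ => by
  rw [run_cons, run_append, hL]
  funext z
  simp [run, Gate.apply, Function.update_of_ne h]

/-- The phase of the `π/8` gate. -/
noncomputable def piEighthPhase : ℂ := Complex.exp (Complex.I * Real.pi / 4)

theorem piEighthPhase_sq : piEighthPhase * piEighthPhase = Complex.I := by
  rw [piEighthPhase, ← Complex.exp_add]
  refine Eq.trans ?_ Complex.exp_pi_div_two_mul_I
  congr 1; ring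

theorem isDiagonal_piEighth {k : ℕ} (i : Fin k) :
    IsDiagonal [Gate.piEighth i] fun z => if z i then piEighthPhase else 1 := fun _ => rfl

/-- The inverse of the `π/8` gate, as its seventh power. -/
def piEighthInv {k : ℕ} (i : Fin k) : List (Gate k) :=
  [.phase i, .phase i, .phase i, .piEighth i]

theorem isDiagonal_piEighthInv {k : ℕ} (i : Fin k) :
    IsDiagonal (piEighthInv i) fun z => if z i then -Complex.I * piEighthPhase else 1 := fun ψ => by
  funext z
  cases h : z i
  · simp [piEighthInv, run, Gate.apply, h]
  · simp only [piEighthInv, run, Gate.apply, h, if_true, List.foldl_cons, List.foldl_nil,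
      piEighthPhase]
    linear_combination (Complex.exp (Complex.I * Real.pi / 4) * Complex.I * ψ z) * Complex.I_mul_I

/-- The doubly controlled sign: a phase for each of the seven parities of three bits, as
`4abc = a + b + c - (a ⊕ b) - (b ⊕ c) - (a ⊕ c) + (a ⊕ b ⊕ c)`. -/
def ccz {k : ℕ} (a b c : Fin k) (hab : a ≠ b) (hac : a ≠ c) (hbc : b ≠ c) : List (Gate k) :=
  [.piEighth a] ++ [.piEighth b] ++ [.piEighth c]
    ++ (.cnot a b hab :: (piEighthInv b ++ [.cnot a b hab]))
    ++ (.cnot b c hbc :: (piEighthInv c ++ [.cnot b c hbc]))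
    ++ (.cnot a c hac :: (piEighthInv c ++ [.cnot a c hac]))
    ++ (.cnot a c hac :: ((.cnot b c hbc :: ([.piEighth c] ++ [.cnot b c hbc])) ++ [.cnot a c hac]))

theorem isDiagonal_ccz {k : ℕ} (a b c : Fin k) (hab : a ≠ b) (hac : a ≠ c) (hbc : b ≠ c) :
    IsDiagonal (ccz a b c hab hac hbc) fun z => if z a && z b && z c then -1 else 1 := by
  have h := ((((((isDiagonal_piEighth a).append (isDiagonal_piEighth b)).append
    (isDiagonal_piEighth c)).append ((isDiagonal_piEighthInv b).conj_cnot hab)).append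
    ((isDiagonal_piEighthInv c).conj_cnot hbc)).append
    ((isDiagonal_piEighthInv c).conj_cnot hac)).append
    (((isDiagonal_piEighth c).conj_cnot hbc).conj_cnot hac)
  refine fun ψ => (h ψ).trans (funext fun z => ?_)
  congr 1
  have h1 := piEighthPhase_sq
  have h2 := Complex.I_mul_I
  cases ha : z a <;> cases hb : z b <;> cases hc : z c <;>
    simp [ha, hb, hc, Function.update_of_ne, hbc]
  all_goals generalize piEighthPhase = w at *; generalize Complex.I = i at *; grind

/-- Conjugating the conditional sign of the qubit `t` by Hadamard gates gives the conditional
negation of the qubit `t`. -/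
theorem run_hadamard_conj {k : ℕ} {L : List (Gate k)} {t : Fin k} {f : Bits k → Bool}
    (hL : IsDiagonal L fun z => if f z && z t then -1 else 1)
    (hf : ∀ z v, f (Function.update z t v) = f z) (ψ : State k) :
    run (Gate.hadamard t :: (L ++ [Gate.hadamard t])) ψ =
      fun z => ψ (Function.update z t (xor (z t) (f z))) := by
  rw [run_cons, run_append, hL]
  funext z
  have hs : (Real.sqrt 2 : ℂ) * (Real.sqrt 2 : ℂ) = 2 := by
    rw [← Complex.ofReal_mul, Real.mul_self_sqrt (by norm_num)]; norm_num
  have hs0 : (Real.sqrt 2 : ℂ) ≠ 0 := fun h => by rw [h] at hs; norm_num at hs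
  simp only [run, List.foldl_cons, List.foldl_nil, Gate.apply, Function.update_self, hf,
    Function.update_idem]
  cases h1 : f z <;> cases h2 : z t <;> simp <;> field_simp <;> rw [pow_two, hs] <;> ring

/-! ### Reversible classical circuits -/

/-- Reversible classical gates: negation, and `z t ↦ z t ⊕ (z i ∧ z j)` for a target `t` distinct
from the controls; the controls may coincide, which gives a controlled negation. -/
inductive ClassicalGate (K : ℕ) : Type where
  | not (i : Fin K)
  | and (i j t : Fin K) (hi : i ≠ t) (hj : j ≠ t)

/-- The action of a classical gate on bit strings. -/
def ClassicalGate.act {K : ℕ} : ClassicalGate K → Bits K → Bits K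
  | .not i, z => Function.update z i (!z i)
  | .and i j t _ _, z => Function.update z t (xor (z t) (z i && z j))

/-- A circuit of quantum gates for a classical gate. -/
def ClassicalGate.gates {K : ℕ} : ClassicalGate K → List (Gate K)
  | .not i => .hadamard i :: ([.phase i, .phase i] ++ [.hadamard i])
  | .and i j t hi hj =>
      if h : i = j then [.cnot i t hi]
      else .hadamard t :: (ccz i j t h hi hj ++ [.hadamard t])

theorem ClassicalGate.act_act {K : ℕ} (g : ClassicalGate K) (z : Bits K) : g.act (g.act z) = z := by
  cases g with
  | not i => simp [act]
  | and i j t hi hj => simp [act, Function.update_of_ne hi, Function.update_of_ne hj]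

theorem ClassicalGate.run_gates {K : ℕ} (g : ClassicalGate K) (ψ : State K) :
    run g.gates ψ = fun z => ψ (g.act z) := by
  cases g with
  | not i =>
    have h : IsDiagonal [Gate.phase i, Gate.phase i] fun z : Bits K =>
        if true && z i then -1 else 1 := fun ψ => by
      funext z
      cases h : z i
      · simp [run, Gate.apply, h]
      · simp only [run, List.foldl_cons, List.foldl_nil, Gate.apply, h, if_true, Bool.and_self]
        rw [← mul_assoc, Complex.I_mul_I]
    refine (run_hadamard_conj (f := fun _ => true) h (fun _ _ => rfl) ψ).trans ?_
    simp [act]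
  | and i j t hi hj =>
    by_cases h : i = j
    · subst h
      simp [gates, act, run, Gate.apply]
    · have hd := isDiagonal_ccz i j t h hi hj
      rw [gates, dif_neg h]
      exact run_hadamard_conj (f := fun z => z i && z j) hd
        (fun z v => by simp [Function.update_of_ne hi, Function.update_of_ne hj]) ψ

theorem ClassicalGate.length_gates {K : ℕ} (g : ClassicalGate K) : g.gates.length ≤ 40 := by
  cases g with
  | not i => simp [gates]
  | and i j t hi hj =>
    rw [gates]
    split_ifs <;> simp [ccz, piEighthInv]

/-- The action of a classical circuit on bit strings. -/
def actList {K : ℕ} (L : List (ClassicalGate K)) (z : Bits K) : Bits K :=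
  L.foldl (fun z g => g.act z) z

/-- The quantum gates of a classical circuit. -/
def quantumGates {K : ℕ} (L : List (ClassicalGate K)) : List (Gate K) :=
  L.flatMap ClassicalGate.gates

theorem actList_append {K : ℕ} (L M : List (ClassicalGate K)) (z : Bits K) :
    actList (L ++ M) z = actList M (actList L z) := List.foldl_append

theorem actList_cons {K : ℕ} (g : ClassicalGate K) (M : List (ClassicalGate K)) (z : Bits K) :
    actList (g :: M) z = actList M (g.act z) := rfl

theorem actList_reverse {K : ℕ} (L : List (ClassicalGate K)) (z : Bits K) :
    actList L.reverse (actList L z) = z := by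
  induction L generalizing z with
  | nil => rfl
  | cons g L ih =>
    rw [List.reverse_cons, actList_append, actList_cons g L, ih]
    exact g.act_act z

theorem run_quantumGates_ket {K : ℕ} (L : List (ClassicalGate K)) (z : Bits K) :
    run (quantumGates L) (ket z) = ket (actList L z) := by
  induction L generalizing z with
  | nil => rfl
  | cons g L ih =>
    rw [quantumGates, List.flatMap_cons, run_append, g.run_gates, ket_comp_involution g.act_act]
    exact ih _

theorem length_quantumGates {K : ℕ} (L : List (ClassicalGate K)) :
    (quantumGates L).length ≤ 40 * L.length := by
  induction L with
  | nil => simp [quantumGates]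
  | cons g L ih =>
    have := g.length_gates
    have h : (quantumGates (g :: L)).length = g.gates.length + (quantumGates L).length := by
      simp [quantumGates]
    rw [h, List.length_cons]
    omega

/-- The circuit that negates the bits `t j` with `s j = true`. -/
noncomputable def nots {K : ℕ} {ι : Type} [Fintype ι] (t : ι → Fin K) (s : ι → Bool) :
    List (ClassicalGate K) :=
  (Finset.univ.toList.filter fun j => s j).map fun j => .not (t j)

theorem actList_nots_aux {K : ℕ} {ι : Type} {t : ι → Fin K} (ht : Function.Injective t)
    (l : List ι) (hl : l.Nodup) (z : Bits K) (q : Fin K) :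
    actList (l.map fun j => ClassicalGate.not (t j)) z q =
      xor (z q) (decide (∃ j ∈ l, t j = q)) := by
  induction l generalizing z with
  | nil => simp [actList]
  | cons a l ih =>
    rw [List.nodup_cons] at hl
    rw [List.map_cons, actList_cons, ih hl.2]
    by_cases h : t a = q
    · subst h
      have : ¬ ∃ j ∈ l, t j = t a := fun ⟨j, hj, e⟩ => hl.1 (ht e ▸ hj)
      simp [ClassicalGate.act, this]
    · simp [ClassicalGate.act, h, Function.update_of_ne (Ne.symm h)]

theorem actList_nots {K : ℕ} {ι : Type} [Fintype ι] {t : ι → Fin K} (ht : Function.Injective t)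
    (s : ι → Bool) (z : Bits K) : actList (nots t s) z = xorAt t s z := by
  funext q
  rw [nots, actList_nots_aux ht _ ((Finset.nodup_toList _).filter _)]
  simp [xorAt, and_comm]

theorem length_nots {K : ℕ} {ι : Type} [Fintype ι] (t : ι → Fin K) (s : ι → Bool) :
    (nots t s).length ≤ Fintype.card ι := by
  rw [nots, List.length_map]
  exact (List.length_filter_le _ _).trans (by simp)

/-- The circuit that adds the bits `c j` to the bits `t j`. -/
noncomputable def cnots {K : ℕ} {ι : Type} [Fintype ι] (c t : ι → Fin K) (h : ∀ i j, c i ≠ t j) :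
    List (ClassicalGate K) :=
  Finset.univ.toList.map fun j => .and (c j) (c j) (t j) (h j j) (h j j)

theorem actList_cnots_aux {K : ℕ} {ι : Type} {c t : ι → Fin K} (ht : Function.Injective t)
    (h : ∀ i j, c i ≠ t j) (l : List ι) (hl : l.Nodup) (z : Bits K) (q : Fin K) :
    actList (l.map fun j => ClassicalGate.and (c j) (c j) (t j) (h j j) (h j j)) z q =
      xor (z q) (decide (∃ j ∈ l, t j = q ∧ z (c j) = true)) := by
  induction l generalizing z with
  | nil => simp [actList]
  | cons a l ih =>
    rw [List.nodup_cons] at hl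
    rw [List.map_cons, actList_cons, ih hl.2]
    have hc : ∀ j, (ClassicalGate.and (c a) (c a) (t a) (h a a) (h a a)).act z (c j) = z (c j) :=
      fun j => by simp [ClassicalGate.act, Function.update_of_ne (h j a)]
    simp only [hc]
    by_cases e : t a = q
    · subst e
      have : ¬ ∃ j ∈ l, t j = t a ∧ z (c j) = true := fun ⟨j, hj, e, _⟩ => hl.1 (ht e ▸ hj)
      simp [ClassicalGate.act, this]
    · simp [ClassicalGate.act, e, Function.update_of_ne (Ne.symm e)]

theorem actList_cnots {K : ℕ} {ι : Type} [Fintype ι] {c t : ι → Fin K}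
    (ht : Function.Injective t) (h : ∀ i j, c i ≠ t j) (z : Bits K) :
    actList (cnots c t h) z = xorAt t (fun j => z (c j)) z := by
  funext q
  rw [cnots, actList_cnots_aux ht h _ (Finset.nodup_toList _)]
  simp [xorAt]

theorem length_cnots {K : ℕ} {ι : Type} [Fintype ι] (c t : ι → Fin K) (h : ∀ i j, c i ≠ t j) :
    (cnots c t h).length = Fintype.card ι := by
  simp [cnots]

/-! ### Boolean circuits as reversible circuits -/

/-- The reversible circuit `L` evaluates `f` on the wires `p`, writing to the wires `anc`, which
have to be zero initially: the result is found at the wires `out`, the other wires do not change,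
and the final content of `anc` is determined by the argument of `f`. -/
structure Computes {K w o s : ℕ} (L : List (ClassicalGate K)) (f : Bits w → Bits o)
    (p : Fin w → Fin K) (anc : Fin s → Fin K) (out : Fin o → Fin K) : Prop where
  out_mem : ∀ j, (∃ i, out j = p i) ∨ ∃ i, out j = anc i
  act_of_ne : ∀ z, (∀ i, z (anc i) = false) → ∀ q, (∀ i, anc i ≠ q) → actList L z q = z q
  act_out : ∀ z, (∀ i, z (anc i) = false) → ∀ j, actList L z (out j) = f (fun i => z (p i)) j
  act_congr : ∀ z z', (∀ i, z (anc i) = false) → (∀ i, z' (anc i) = false) →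
    (∀ i, z (p i) = z' (p i)) → ∀ i, actList L z (anc i) = actList L z' (anc i)

/-- Prepends a gate whose value `v` is written to the first fresh wire. -/
theorem Computes.cons {K w o s : ℕ} {L M : List (ClassicalGate K)} {f : Bits (w + 1) → Bits o}
    {p : Fin w → Fin K} {anc : Fin (s + 1) → Fin K} {out : Fin o → Fin K}
    (hanc : Function.Injective anc) (hp : ∀ i j, p i ≠ anc j) {v : Bits w → Bool}
    (hM : ∀ z, z (anc 0) = false → actList M z = Function.update z (anc 0) (v fun i => z (p i)))
    (h : Computes L f (Fin.snoc (α := fun _ => Fin K) p (anc 0)) (fun j => anc j.succ) out) :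
    Computes (M ++ L) (fun x => f (Fin.snoc (α := fun _ => Bool) x (v x))) p anc out := by
  have h0 : ∀ z, (∀ i, z (anc i) = false) → ∀ i : Fin s, actList M z (anc i.succ) = false :=
    fun z hz i => by
      rw [hM z (hz 0), Function.update_of_ne fun e => Fin.succ_ne_zero i (hanc e), hz]
  have hsnoc : ∀ z, (∀ i, z (anc i) = false) →
      (fun i => actList M z (Fin.snoc (α := fun _ : Fin (w + 1) => Fin K) p (anc 0) i)) =
        Fin.snoc (α := fun _ => Bool) (fun i => z (p i)) (v fun i => z (p i)) := fun z hz => by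
    funext i
    rw [hM z (hz 0)]
    refine Fin.lastCases ?_ (fun i => ?_) i
    · simp
    · simp [Function.update_of_ne (hp i 0)]
  refine ⟨fun j => ?_, fun z hz q hq => ?_, fun z hz j => ?_, fun z z' hz hz' he i => ?_⟩
  · obtain ⟨i, hi⟩ | ⟨i, hi⟩ := h.out_mem j
    · rw [hi]
      refine Fin.lastCases ?_ (fun i => ?_) i
      · exact Or.inr ⟨0, by simp⟩
      · exact Or.inl ⟨i, by simp⟩
    · exact Or.inr ⟨i.succ, hi⟩
  · rw [actList_append, h.act_of_ne _ (h0 z hz) q fun i => hq _, hM z (hz 0),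
      Function.update_of_ne (hq 0).symm]
  · rw [actList_append, h.act_out _ (h0 z hz), hsnoc z hz]
  · have he' : (fun i => z (p i)) = fun i => z' (p i) := funext he
    rw [actList_append, actList_append]
    refine Fin.cases ?_ (fun i => ?_) i
    · rw [h.act_of_ne _ (h0 z hz) _ fun i e => Fin.succ_ne_zero i (hanc e),
        h.act_of_ne _ (h0 z' hz') _ fun i e => Fin.succ_ne_zero i (hanc e), hM z (hz 0),
        hM z' (hz' 0), Function.update_self, Function.update_self, he']
    · refine h.act_congr _ _ (h0 z hz) (h0 z' hz') (fun i => ?_) i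
      have := (hsnoc z hz).trans ((congrArg (fun x : Bits w =>
        (Fin.snoc (α := fun _ => Bool) x (v x) : Bits (w + 1))) he').trans (hsnoc z' hz').symm)
      exact congrFun this i

theorem snoc_ne {K w s : ℕ} {p : Fin w → Fin K} {anc : Fin (s + 1) → Fin K}
    (hanc : Function.Injective anc) (hp : ∀ i j, p i ≠ anc j) (i : Fin (w + 1)) (j : Fin s) :
    Fin.snoc (α := fun _ => Fin K) p (anc 0) i ≠ anc j.succ := by
  refine Fin.lastCases ?_ (fun i => ?_) i
  · rw [Fin.snoc_last]; exact fun h => Fin.succ_ne_zero j (hanc h).symm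
  · rw [Fin.snoc_castSucc]; exact hp i j.succ

theorem BoolCircuit.exists_computes {K o w : ℕ} (C : BoolCircuit o w) {s : ℕ} (hs : C.size = s)
    (p : Fin w → Fin K) (anc : Fin s → Fin K) (hanc : Function.Injective anc)
    (hp : ∀ i j, p i ≠ anc j) :
    ∃ L out, L.length ≤ 2 * C.size ∧ Computes L C.eval p anc out := by
  induction C generalizing s with
  | outputs sel =>
    exact ⟨[], fun j => p (sel j), by simp, fun j => Or.inl ⟨_, rfl⟩, fun _ _ _ _ => rfl,
      fun _ _ _ => rfl, fun z z' hz hz' _ i => by simp [actList, hz, hz']⟩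
  | const v rest ih =>
    obtain ⟨s, rfl⟩ : ∃ s', s = s' + 1 := ⟨rest.size, hs.symm⟩
    obtain ⟨L, out, hL, h⟩ := ih (Nat.succ_injective hs) _ (fun j => anc j.succ)
      (fun _ _ e => Fin.succ_injective _ (hanc e)) (snoc_ne hanc hp)
    refine ⟨(if v then [.not (anc 0)] else []) ++ L, out, ?_,
      h.cons hanc hp (v := fun _ => v) fun z hz => ?_⟩
    · rw [List.length_append, size]
      split_ifs <;> simp <;> omega
    · cases v
      · have e : Function.update z (anc 0) false = z := by
          rw [← hz]; exact Function.update_eq_self _ _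
        rw [e]; rfl
      · simp [actList, ClassicalGate.act, hz]
  | nand i j rest ih =>
    obtain ⟨s, rfl⟩ : ∃ s', s = s' + 1 := ⟨rest.size, hs.symm⟩
    obtain ⟨L, out, hL, h⟩ := ih (Nat.succ_injective hs) _ (fun j => anc j.succ)
      (fun _ _ e => Fin.succ_injective _ (hanc e)) (snoc_ne hanc hp)
    refine ⟨[.and (p i) (p j) (anc 0) (hp i 0) (hp j 0), .not (anc 0)] ++ L, out, ?_,
      h.cons hanc hp (v := fun x => !(x i && x j)) fun z hz => ?_⟩
    · rw [List.length_append, size]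
      simp; omega
    · simp [actList, ClassicalGate.act, hz]

/-- A Boolean circuit as an oracle that can be queried in superposition: evaluating it, adding
output bits to target wires and running the evaluation backwards leaves the auxiliary wires as they
were, so that they do not become entangled with the other wires. -/
theorem BoolCircuit.exists_classicalCircuit {K o w : ℕ} (C : BoolCircuit o w) (p : Fin w → Fin K)
    (anc : Fin C.size → Fin K) (hanc : Function.Injective anc) (hp : ∀ i j, p i ≠ anc j)
    {ι : Type} [Fintype ι] (sel : ι → Fin o) (t : ι → Fin K) (ht : Function.Injective t)
    (htp : ∀ i j, p i ≠ t j) (hta : ∀ i j, anc i ≠ t j) :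
    ∃ L : List (ClassicalGate K), L.length ≤ 4 * C.size + Fintype.card ι ∧
      ∀ z, (∀ i, z (anc i) = false) →
        actList L z = xorAt t (fun j => C.eval (fun i => z (p i)) (sel j)) z := by
  obtain ⟨L, out, hL, h⟩ := C.exists_computes rfl p anc hanc hp
  have hout : ∀ i j, out (sel i) ≠ t j := fun i j => by
    obtain ⟨l, e⟩ | ⟨l, e⟩ := h.out_mem (sel i)
    · rw [e]; exact htp _ _
    · rw [e]; exact hta _ _
  refine ⟨L ++ cnots (fun j => out (sel j)) t hout ++ L.reverse, ?_, fun z hz => ?_⟩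
  · rw [List.length_append, List.length_append, length_cnots, List.length_reverse]
    omega
  · rw [actList_append, actList_append, actList_cnots ht]
    simp only [h.act_out z hz]
    set s : ι → Bool := fun j => C.eval (fun i => z (p i)) (sel j)
    have hz' : ∀ i, xorAt t s z (anc i) = false := fun i => by
      rw [xorAt_apply_of_ne _ _ fun j => (hta i j).symm, hz]
    -- The evaluation neither reads nor writes the target wires.
    have key : xorAt t s (actList L z) = actList L (xorAt t s z) := by
      funext q
      by_cases hq : ∃ i, anc i = q
      · obtain ⟨i, rfl⟩ := hq
        rw [xorAt_apply_of_ne _ _ fun j => (hta i j).symm]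
        exact h.act_congr _ _ hz hz'
          (fun i => (xorAt_apply_of_ne _ _ fun j => (htp i j).symm).symm) i
      · push Not at hq
        rw [h.act_of_ne _ hz' q hq]
        simp only [xorAt, h.act_of_ne _ hz q hq]
    rw [key, actList_reverse]

/-- A circuit for the conjunction of the bit `acc` and the conditions that the bits `x (p j)` are
equal to `r j`. -/
def eqTestAux : {w : ℕ} → (l : ℕ) → (p : Fin l → Fin w) → (r : Bits l) → (acc : Fin w) →
    BoolCircuit 1 w
  | _, 0, _, _, acc => .outputs fun _ => acc
  | w, l + 1, p, r, acc =>
      -- The bit or its negation, according to `r 0`; then the conjunction by two gates.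
      .nand (p 0) (p 0) <|
      .nand acc.castSucc (if r 0 then (p 0).castSucc else Fin.last w) <|
      .nand (Fin.last (w + 1)) (Fin.last (w + 1)) <|
      eqTestAux l (fun j => (p j.succ).castSucc.castSucc.castSucc) (fun j => r j.succ)
        (Fin.last (w + 2))

theorem eval_eqTestAux {w : ℕ} (l : ℕ) (p : Fin l → Fin w) (r : Bits l) (acc : Fin w)
    (x : Bits w) (i : Fin 1) : (eqTestAux l p r acc).eval x i = true ↔
      x acc = true ∧ ∀ j, x (p j) = r j := by
  induction l generalizing w with
  | zero => simp [eqTestAux, BoolCircuit.eval]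
  | succ l ih =>
    simp only [eqTestAux, BoolCircuit.eval, ih, Fin.snoc_last, Fin.snoc_castSucc,
      Fin.forall_fin_succ]
    cases h : r 0 <;> simp [and_assoc]

theorem size_eqTestAux {w : ℕ} (l : ℕ) (p : Fin l → Fin w) (r : Bits l) (acc : Fin w) :
    (eqTestAux l p r acc).size = 3 * l := by
  induction l generalizing w with
  | zero => simp [eqTestAux, BoolCircuit.size]
  | succ l ih => simp only [eqTestAux, BoolCircuit.size, ih]; ring

/-- A circuit that tests whether its input is `r`. -/
def eqTest {l : ℕ} (r : Bits l) : BoolCircuit 1 l :=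
  .const true (eqTestAux l Fin.castSucc r (Fin.last l))

theorem eval_eqTest {l : ℕ} (r x : Bits l) (i : Fin 1) :
    (eqTest r).eval x i = true ↔ x = r := by
  simp [eqTest, BoolCircuit.eval, eval_eqTestAux, funext_iff]

theorem size_eqTest {l : ℕ} (r : Bits l) : (eqTest r).size = 3 * l + 1 := by
  simp [eqTest, BoolCircuit.size, size_eqTestAux]

/-! ### Reprogramming the oracle at one point -/

/-- The probability that measuring the input register of the gate number `i`, if this gate is a
query, just before it is applied yields `r`; zero for other gates. -/
noncomputable def queryWeight {k a b : ℕ} (O : Bits a → Bits b) (C : List (OracleGate k a b))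
    (ψ : State k) (r : Bits a) (i : ℕ) : ℝ :=
  match C[i]? with
  | some (.query w) => (runOracle O (C.take i) ψ).prob fun z => (fun j => z (w (Sum.inl j))) = r
  | _ => 0

theorem queryWeight_nonneg {k a b : ℕ} (O : Bits a → Bits b) (C : List (OracleGate k a b))
    (ψ : State k) (r : Bits a) (i : ℕ) : 0 ≤ queryWeight O C ψ r i := by
  rw [queryWeight]
  split
  · exact State.prob_nonneg _ _
  · exact le_rfl

theorem queryWeight_cons_succ {k a b : ℕ} (O : Bits a → Bits b) (g : OracleGate k a b)
    (C : List (OracleGate k a b)) (ψ : State k) (r : Bits a) (i : ℕ) :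
    queryWeight O (g :: C) ψ r (i + 1) = queryWeight O C (g.apply O ψ) r i := by
  simp [queryWeight, runOracle_cons]

/-- The part of `ψ` that satisfies `P`. -/
noncomputable def State.restrict {k : ℕ} (P : Bits k → Prop) [DecidablePred P] (ψ : State k) :
    State k := fun z => if P z then ψ z else 0

theorem State.norm_restrict {k : ℕ} (P : Bits k → Prop) [DecidablePred P] (ψ : State k) :
    (ψ.restrict P).norm = Real.sqrt (ψ.prob P) := by
  rw [State.norm, State.normSq, State.prob]
  congr 1
  refine Finset.sum_congr rfl fun z _ => ?_
  rw [State.restrict]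
  split_ifs <;> simp

theorem State.norm_restrict_le {k : ℕ} (P : Bits k → Prop) [DecidablePred P] (ψ : State k) :
    (ψ.restrict P).norm ≤ ψ.norm := by
  rw [State.norm_restrict, State.norm]
  refine Real.sqrt_le_sqrt (Finset.sum_le_sum fun z _ => ?_)
  split_ifs
  · exact le_rfl
  · positivity

theorem norm_apply_sub_apply_le {k a b : ℕ} {O O' : Bits a → Bits b} {r : Bits a}
    (hO : ∀ x, x ≠ r → O' x = O x) (g : OracleGate k a b) (ψ : State k) :
    (g.apply O' ψ - g.apply O ψ).norm ≤ 2 * Real.sqrt (queryWeight O [g] ψ r 0) := by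
  cases g with
  | basic g =>
    rw [OracleGate.apply, OracleGate.apply, sub_self]
    simp [State.norm, State.normSq]
  | query w =>
    set φ := ψ.restrict fun z => (fun j => z (w (Sum.inl j))) = r
    -- The two oracles act differently only on the part of `ψ` whose input register reads `r`.
    have h : (OracleGate.query w).apply O' ψ - (OracleGate.query w).apply O ψ =
        (OracleGate.query w).apply O' φ - (OracleGate.query w).apply O φ := by
      funext z
      simp only [Pi.sub_apply, OracleGate.apply_query, φ, State.restrict, queryMap_inl]
      split_ifs with hz
      · rfl
      · rw [queryMap, queryMap, hO _ hz]; simp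
    rw [h]
    refine (State.norm_sub_le _ _).trans ?_
    rw [State.norm, State.norm, OracleGate.normSq_apply, OracleGate.normSq_apply, ← State.norm,
      State.norm_restrict, ← two_mul]
    exact le_rfl

/-- Replacing the oracle `O` by one that agrees with it except at `r` changes the final state by at
most twice the sum of the amplitudes with which the circuit queries `O` at `r`. -/
theorem norm_runOracle_sub_le {k a b : ℕ} {O O' : Bits a → Bits b} {r : Bits a}
    (hO : ∀ x, x ≠ r → O' x = O x) (C : List (OracleGate k a b)) (ψ : State k) :
    (runOracle O' C ψ - runOracle O C ψ).norm ≤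
      ∑ i ∈ Finset.range C.length, 2 * Real.sqrt (queryWeight O C ψ r i) := by
  induction C generalizing ψ with
  | nil => simp [runOracle, State.norm, State.normSq]
  | cons g C ih =>
    -- The difference made by the first gate, moved through the rest of the circuit without changing
    -- its norm, and the difference made by the rest.
    have e : runOracle O' (g :: C) ψ - runOracle O (g :: C) ψ =
        runOracle O' C (g.apply O' ψ - g.apply O ψ) +
          (runOracle O' C (g.apply O ψ) - runOracle O C (g.apply O ψ)) := by
      rw [(runOracle_isLinearMap O' C).map_sub, runOracle_cons, runOracle_cons]
      abel
    have h0 : queryWeight O (g :: C) ψ r 0 = queryWeight O [g] ψ r 0 := by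
      simp [queryWeight]
    rw [e, List.length_cons, Finset.sum_range_succ', h0]
    simp only [queryWeight_cons_succ]
    refine (State.norm_add_le _ _).trans ?_
    rw [add_comm]
    refine add_le_add (ih _) ?_
    rw [State.norm, normSq_runOracle, ← State.norm]
    exact norm_apply_sub_apply_le hO g ψ

theorem abs_prob_sub_prob_le {k : ℕ} {ψ φ : State k} (hψ : ψ.normSq = 1) (hφ : φ.normSq = 1)
    (P : Bits k → Prop) [DecidablePred P] : |ψ.prob P - φ.prob P| ≤ 2 * (ψ - φ).norm := by
  have hsq : ∀ χ : State k, χ.prob P = (χ.restrict P).norm ^ 2 := fun χ => by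
    rw [State.norm_restrict, Real.sq_sqrt (State.prob_nonneg _ _)]
  have hle : ∀ χ : State k, χ.normSq = 1 → (χ.restrict P).norm ≤ 1 := fun χ h =>
    (State.norm_restrict_le P χ).trans (by rw [State.norm, h, Real.sqrt_one])
  have hsub : ψ.restrict P - φ.restrict P = (ψ - φ).restrict P := by
    funext z
    simp only [State.restrict, Pi.sub_apply]
    split_ifs <;> simp
  have h1 := State.abs_norm_sub_norm_le (ψ.restrict P) (φ.restrict P)
  rw [hsub] at h1
  have h2 := h1.trans (State.norm_restrict_le P (ψ - φ))
  rw [hsq, hsq, sq_sub_sq, abs_mul, abs_of_nonneg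
    (add_nonneg (State.norm_nonneg _) (State.norm_nonneg _))]
  refine mul_le_mul ?_ h2 (abs_nonneg _) (by norm_num)
  linarith [hle ψ hψ, hle φ hφ]

/-- One-way to hiding: the output distribution of a circuit changes little when the oracle is
reprogrammed at `r`, unless measuring one of its queries is likely to yield `r`. -/
theorem abs_prob_runOracle_sub_le {k a b : ℕ} {O O' : Bits a → Bits b} {r : Bits a}
    (hO : ∀ x, x ≠ r → O' x = O x) (C : List (OracleGate k a b)) {ψ : State k}
    (hψ : ψ.normSq = 1) (P : Bits k → Prop) [DecidablePred P] :
    |(runOracle O' C ψ).prob P - (runOracle O C ψ).prob P| ≤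
      4 * ∑ i ∈ Finset.range C.length, Real.sqrt (queryWeight O C ψ r i) := by
  have h := abs_prob_sub_prob_le ((normSq_runOracle O' C ψ).trans hψ)
    ((normSq_runOracle O C ψ).trans hψ) P
  have h' := norm_runOracle_sub_le hO C ψ
  rw [← Finset.mul_sum] at h'
  linarith

/-! ### The adversary as a single circuit -/

/-- The qubits of an adversary with a deferred measurement: its own `k` qubits, a register for the
challenge image `y` of `r` bits, and a copy of the two challenge messages of `m` bits. -/
abbrev CoreWire (k r m : ℕ) : Type := Fin k ⊕ (Fin r ⊕ (Fin m ⊕ Fin m))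

/-- The number of these qubits. -/
abbrev coreQubits (k r m : ℕ) : ℕ := Fintype.card (CoreWire k r m)

/-- The numbering of these qubits. -/
noncomputable def coreEquiv (k r m : ℕ) : CoreWire k r m ≃ Fin (coreQubits k r m) :=
  Fintype.equivFin _

/-- The adversary's own qubits. -/
noncomputable def ownWire {k : ℕ} (r m : ℕ) : Fin k ↪ Fin (coreQubits k r m) :=
  Function.Embedding.inl.trans (coreEquiv k r m).toEmbedding

/-- The qubits of the register for the challenge image. -/
noncomputable def imageWire (k : ℕ) {r : ℕ} (m : ℕ) : Fin r ↪ Fin (coreQubits k r m) :=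
  (Function.Embedding.inl.trans Function.Embedding.inr).trans (coreEquiv k r m).toEmbedding

/-- The qubits of the copy of the challenge messages. -/
noncomputable def copyWire (k r : ℕ) {m : ℕ} : Fin m ⊕ Fin m ↪ Fin (coreQubits k r m) :=
  (Function.Embedding.inr.trans Function.Embedding.inr).trans (coreEquiv k r m).toEmbedding

/-- The string with the given content of the three registers. -/
noncomputable def join {k r m : ℕ} (u : Bits k) (y : Bits r) (c : Fin m ⊕ Fin m → Bool) :
    Bits (coreQubits k r m) :=
  fun q => Sum.elim u (Sum.elim y c) ((coreEquiv k r m).symm q)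

section Registers

variable {k r m : ℕ} (u : Bits k) (y : Bits r) (c : Fin m ⊕ Fin m → Bool)

theorem join_ownWire (j : Fin k) : join u y c (ownWire r m j) = u j := by
  simp [join, ownWire]

theorem join_imageWire (j : Fin r) : join u y c (imageWire k m j) = y j := by
  simp [join, imageWire]

theorem join_copyWire (j : Fin m ⊕ Fin m) : join u y c (copyWire k r j) = c j := by
  simp [join, copyWire]

theorem wire_cases {P : Fin (coreQubits k r m) → Prop} (h1 : ∀ j, P (ownWire r m j))
    (h2 : ∀ j, P (imageWire k m j)) (h3 : ∀ j, P (copyWire k r j)) (q : Fin (coreQubits k r m)) :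
    P q := by
  obtain ⟨w, rfl⟩ := (coreEquiv k r m).surjective q
  obtain j | j | j := w
  · exact h1 j
  · exact h2 j
  · exact h3 j

theorem own_ne_image (i : Fin k) (j : Fin r) : ownWire r m i ≠ imageWire k m j := by
  simp [ownWire, imageWire]

theorem own_ne_copy (i : Fin k) (j : Fin m ⊕ Fin m) : ownWire r m i ≠ copyWire k r j := by
  simp [ownWire, copyWire]

theorem image_ne_copy (i : Fin r) (j : Fin m ⊕ Fin m) : imageWire k m i ≠ copyWire k r j := by
  simp [imageWire, copyWire]

theorem overlay_join (u' : Bits k) : overlay (ownWire r m) (join u' y c) u = join u y c := by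
  funext q
  induction q using wire_cases with | h1 j | h2 j | h3 j
  · rw [overlay_apply, join_ownWire]
  · rw [overlay_of_ne _ _ _ fun i => own_ne_image i j, join_imageWire, join_imageWire]
  · rw [overlay_of_ne _ _ _ fun i => own_ne_copy i j, join_copyWire, join_copyWire]

theorem xorAt_own_join {ι : Type} [Fintype ι] (t : ι → Fin k) (s : ι → Bool) :
    xorAt (fun i => ownWire r m (t i)) s (join u y c) = join (xorAt t s u) y c := by
  rw [← overlay_join (xorAt t s u) y c u, overlay_xorAt, overlay_join]

theorem xorAt_copy_join (s : Fin m ⊕ Fin m → Bool) :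
    xorAt (copyWire k r) s (join u y fun _ => false) = join u y s := by
  funext q
  induction q using wire_cases with | h1 j | h2 j | h3 j
  · rw [xorAt_apply_of_ne _ _ fun i => (own_ne_copy j i).symm, join_ownWire, join_ownWire]
  · rw [xorAt_apply_of_ne _ _ fun i => (image_ne_copy j i).symm, join_imageWire, join_imageWire]
  · rw [xorAt_apply (copyWire k r).injective, join_copyWire, join_copyWire, Bool.false_xor]

end Registers

/-- Adding a concatenation is adding its parts, the second one in two steps. -/
theorem xorAt_append {k r m : ℕ} {w : Fin (r + m) → Fin k} (hw : Function.Injective w)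
    (y : Bits r) (z μ : Bits m) (u : Bits k) :
    xorAt (fun j => w (Fin.natAdd r j)) μ (xorAt (fun j => w (Fin.natAdd r j)) z
      (xorAt (fun j => w (Fin.castAdd m j)) y u)) = xorAt w (Fin.append y (z.add μ)) u := by
  have h1 : Function.Injective fun j => w (Fin.natAdd r j) :=
    hw.comp (Fin.natAdd_injective m r)
  have h2 : Function.Injective fun j => w (Fin.castAdd m j) :=
    hw.comp (Fin.castAdd_injective r m)
  have h3 : ∀ i j, w (Fin.natAdd r i) ≠ w (Fin.castAdd m j) := fun i j e => by
    have := congrArg Fin.val (hw e)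
    simp at this; omega
  funext q
  by_cases hq : ∃ j, w j = q
  · obtain ⟨j, rfl⟩ := hq
    rw [xorAt_apply hw]
    refine Fin.addCases (fun j => ?_) (fun j => ?_) j
    · rw [xorAt_apply_of_ne _ _ fun i => h3 i j, xorAt_apply_of_ne _ _ fun i => h3 i j,
        xorAt_apply h2, Fin.append_left]
    · rw [xorAt_apply h1, xorAt_apply h1, xorAt_apply_of_ne _ _ fun i => (h3 j i).symm,
        Fin.append_right, Bits.add, Bool.xor_assoc]
  · push Not at hq
    rw [xorAt_apply_of_ne _ _ fun i => hq _, xorAt_apply_of_ne _ _ fun i => hq _,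
      xorAt_apply_of_ne _ _ fun i => hq _, xorAt_apply_of_ne _ _ hq]

section Core

variable {a pk r m : ℕ} (A : CPAAdversary a m pk m (r + m)) (b : Bool) (z : Bits m)

/-- The classical circuit that copies the challenge messages, which has the effect of a measurement,
and then adds the ciphertext `(y, z ⊕ μ)` to the answer register, for the message `μ` selected
by `b`. -/
noncomputable def challengeCircuit : List (ClassicalGate (coreQubits A.qubits r m)) :=
  cnots (fun j => ownWire r m (A.challenge (Sum.inl j))) (copyWire A.qubits r)
      (fun _ j => own_ne_copy _ j) ++
    (cnots (imageWire A.qubits m) (fun j => ownWire r m (A.challenge (Sum.inr (Fin.castAdd m j))))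
      (fun i _ => (own_ne_image _ i).symm) ++
    (nots (fun j => ownWire r m (A.challenge (Sum.inr (Fin.natAdd r j)))) z ++
    cnots (fun j => copyWire A.qubits r (if b then Sum.inr j else Sum.inl j))
      (fun j => ownWire r m (A.challenge (Sum.inr (Fin.natAdd r j))))
      (fun _ _ => (own_ne_copy _ _).symm)))

/-- The whole computation of the adversary as an oracle circuit that answers the challenge with the
ciphertext `(y, z ⊕ μ)`. -/
noncomputable def coreCircuit : List (OracleGate (coreQubits A.qubits r m) a m) :=
  A.before.map (OracleGate.map (ownWire r m)) ++
    ((quantumGates (challengeCircuit A b z)).map OracleGate.basic ++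
    A.after.map (OracleGate.map (ownWire r m)))

theorem length_coreCircuit : (coreCircuit A b z).length ≤ A.size + 40 * (r + 4 * m) := by
  have h1 := length_quantumGates (challengeCircuit A b z)
  have h2 : (challengeCircuit A b z).length ≤ (m + m) + (r + (m + m)) := by
    have := length_nots (fun j => ownWire r m (A.challenge (Sum.inr (Fin.natAdd r j)))) z
    simp only [challengeCircuit, List.length_append, length_cnots, Fintype.card_sum,
      Fintype.card_fin] at this ⊢
    omega
  simp only [coreCircuit, List.length_append, List.length_map, CPAAdversary.size]
  omega

theorem actList_challengeCircuit (u : Bits A.qubits) (y : Bits r) :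
    actList (challengeCircuit A b z) (join u y fun _ => false) =
      join (xorAt (fun j => A.challenge (Sum.inr j)) (Fin.append y (z.add fun j =>
        u (A.challenge (Sum.inl (if b then Sum.inr j else Sum.inl j))))) u) y
        fun j => u (A.challenge (Sum.inl j)) := by
  have hinj : Function.Injective fun j : Fin (r + m) => A.challenge (Sum.inr j) :=
    A.challenge.injective.comp Sum.inr_injective
  have h1 : Function.Injective fun j : Fin r =>
      ownWire r m (A.challenge (Sum.inr (Fin.castAdd m j))) :=
    (ownWire r m).injective.comp (hinj.comp (Fin.castAdd_injective r m))
  have h2 : Function.Injective fun j : Fin m =>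
      ownWire r m (A.challenge (Sum.inr (Fin.natAdd r j))) :=
    (ownWire r m).injective.comp (hinj.comp (Fin.natAdd_injective m r))
  rw [challengeCircuit, actList_append, actList_append, actList_append,
    actList_cnots (copyWire _ _).injective, actList_cnots h1, actList_nots h2, actList_cnots h2]
  simp only [join_ownWire]
  rw [xorAt_copy_join]
  simp only [join_imageWire]
  rw [xorAt_own_join, xorAt_own_join]
  simp only [join_copyWire]
  rw [xorAt_own_join]
  congr 1
  exact xorAt_append hinj y z _ u

/-- The effect of the challenge circuit: the sum over all outcomes of the measurement of the
challenge messages, tagged by the copy of the messages. -/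
theorem run_challengeCircuit (y : Bits r) (φ : State A.qubits) :
    run (quantumGates (challengeCircuit A b z))
        (State.lift (ownWire r m) (join (fun _ => false) y fun _ => false) φ) =
      ∑ c : Fin m ⊕ Fin m → Bool, State.lift (ownWire r m) (join (fun _ => false) y c)
        (State.xorAt (fun j => A.challenge (Sum.inr j))
          (Fin.append y (z.add fun j => c (if b then Sum.inr j else Sum.inl j)))
          (State.project (fun j => A.challenge (Sum.inl j)) c φ)) := by
  have hproj : ∀ c, IsLinearMap ℂ
      (State.project (fun j : Fin m ⊕ Fin m => A.challenge (Sum.inl j)) c) := fun c => by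
    constructor
    · intro x y; funext Z; simp only [State.project, Pi.add_apply]; split_ifs <;> simp
    · intro t x; funext Z; simp only [State.project, Pi.smul_apply]; split_ifs <;> simp
  have hx : ∀ c : Fin m ⊕ Fin m → Bool, IsLinearMap ℂ
      (State.xorAt (fun j => A.challenge (Sum.inr j))
        (Fin.append y (z.add fun j => c (if b then Sum.inr j else Sum.inl j)))) := fun c =>
    isLinearMap_comp _
  have hterm := fun c => IsLinearMap.comp' (lift_isLinearMap (ownWire r m)
    (join (fun _ => false) y c)) (IsLinearMap.comp' (hx c) (hproj c))
  refine IsLinearMap.eq_of_ket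
    (g := fun φ => ∑ c : Fin m ⊕ Fin m → Bool, State.lift (ownWire r m) (join (fun _ => false) y c)
        (State.xorAt (fun j => A.challenge (Sum.inr j))
          (Fin.append y (z.add fun j => c (if b then Sum.inr j else Sum.inl j)))
          (State.project (fun j => A.challenge (Sum.inl j)) c φ)))
    (IsLinearMap.comp' (run_isLinearMap _) (lift_isLinearMap _ _))
    ⟨fun x y => ?_, fun t x => ?_⟩ (fun u => ?_) φ
  · rw [← Finset.sum_add_distrib]
    exact Finset.sum_congr rfl fun c _ => (hterm c).map_add x y
  · rw [Finset.smul_sum]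
    exact Finset.sum_congr rfl fun c _ => (hterm c).map_smul t x
  · rw [lift_ket, overlay_join, run_quantumGates_ket, actList_challengeCircuit,
      Finset.sum_eq_single fun j => u (A.challenge (Sum.inl j))]
    · have h1 : State.project (fun j => A.challenge (Sum.inl j))
          (fun j => u (A.challenge (Sum.inl j))) (ket u) = ket u := by
        funext Z
        simp only [State.project, ket_apply]
        split_ifs with h h' h'
        · rfl
        · rfl
        · exact absurd (by rw [h']) h
        · rfl
      have h2 : ∀ s, State.xorAt (fun j : Fin (r + m) => A.challenge (Sum.inr j)) s (ket u) =
          ket (xorAt (fun j => A.challenge (Sum.inr j)) s u) := fun s =>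
        ket_comp_involution (xorAt_xorAt _ s) u
      rw [h1, h2, lift_ket, overlay_join]
    · intro c _ hc
      have h1 : State.project (fun j => A.challenge (Sum.inl j)) c (ket u) = 0 := by
        funext Z
        simp only [State.project, ket_apply]
        split_ifs with h h'
        · exact absurd (by rw [← h, h']) hc
        · rfl
        · rfl
      rw [h1]
      exact (IsLinearMap.comp' (lift_isLinearMap (ownWire r m) (join (fun _ => false) y c))
        (hx c)).map_zero
    · exact fun h => absurd (Finset.mem_univ _) h

/-- States that carry different copies of the challenge messages do not interfere. -/
theorem prob_sum_lift {k : ℕ} (y : Bits r) (χ : (Fin m ⊕ Fin m → Bool) → State k)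
    (P : Bits (coreQubits k r m) → Prop) [DecidablePred P] :
    State.prob (∑ c, State.lift (ownWire r m) (join (fun _ => false) y c) (χ c)) P =
      ∑ c, (χ c).prob fun u => P (join u y c) := by
  have h : ∀ c, (State.lift (ownWire r m) (join (fun _ => false) y c) (χ c)).prob P =
      (χ c).prob fun u => P (join u y c) := fun c => by
    rw [prob_lift]; simp only [overlay_join]
  rw [← Finset.sum_congr rfl fun c _ => h c]
  simp only [State.prob]
  rw [Finset.sum_comm]
  refine Finset.sum_congr rfl fun Z _ => ?_
  split_ifs
  · rw [Finset.sum_apply]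
    set c₀ : Fin m ⊕ Fin m → Bool := fun j => Z (copyWire k r j) with hc₀
    have h0 : ∀ c, c ≠ c₀ →
        State.lift (ownWire r m) (join (fun _ => false) y c) (χ c) Z = 0 := fun c hc => by
      refine if_neg fun hZ => hc (funext fun j => ?_)
      exact ((hZ _ fun i => own_ne_copy i j).trans (join_copyWire _ _ _ j)).symm
    rw [Finset.sum_eq_single c₀ (fun c _ hc => h0 c hc) (fun h => absurd (Finset.mem_univ _) h),
      Finset.sum_eq_single c₀ (fun c _ hc => by rw [h0 c hc]; simp)
        (fun h => absurd (Finset.mem_univ _) h)]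
  · simp

theorem sum_sumElim {f : (Fin m ⊕ Fin m → Bool) → ℝ} :
    ∑ c, f c = ∑ m₀ : Bits m, ∑ m₁ : Bits m, f (Sum.elim m₀ m₁) := by
  rw [← (Equiv.sumArrowEquivProdArrow (Fin m) (Fin m) Bool).symm.sum_comp, Fintype.sum_prod_type]
  rfl

/-- Deferred measurement: copying the challenge messages to fresh qubits instead of measuring them
does not change the probability of the output. -/
theorem prob_coreCircuit (O : Bits a → Bits m) (key : Bits pk) (y : Bits r) (bit : Bool) :
    A.prob O key (fun m₀ m₁ => Fin.append y (z.add (if b then m₁ else m₀))) bit =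
      (runOracle O (coreCircuit A b z)
        (ket (join (place A.input key) y fun _ => false))).prob
          fun Z => Z (ownWire r m A.output) = bit := by
  rw [← overlay_join (place A.input key) y (fun _ => false) (fun _ => false), ← lift_ket,
    coreCircuit, runOracle_append, runOracle_append, runOracle_map, runOracle_basic,
    run_challengeCircuit]
  rw [← (runOracle_isLinearMap O _).mk'_apply, map_sum]
  simp only [IsLinearMap.mk'_apply, runOracle_map]
  rw [prob_sum_lift, sum_sumElim]
  simp only [join_ownWire, CPAAdversary.prob]
  refine Finset.sum_congr rfl fun m₀ _ => Finset.sum_congr rfl fun m₁ _ => ?_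
  have : (fun j => (Sum.elim m₀ m₁ : Fin m ⊕ Fin m → Bool) (if b then Sum.inr j else Sum.inl j)) =
      if b then m₁ else m₀ := by
    cases b <;> rfl
  rw [this]

end Core

/-! ### Averages -/

theorem expect_involution {α : Type} [Fintype α] {σ : α → α} (h : ∀ x, σ (σ x) = x) (f : α → ℝ) :
    𝔼 x, f (σ x) = 𝔼 x, f x :=
  Fintype.expect_equiv (Function.Involutive.toPerm σ h) _ _ fun _ => rfl

theorem expect_reorder {α β γ δ : Type} [Fintype α] [Fintype β] [Fintype γ] [Fintype δ]
    (f : α → β → γ → δ → ℝ) :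
    𝔼 x, 𝔼 y, 𝔼 z, 𝔼 w, f x y z w = 𝔼 z, 𝔼 y, 𝔼 w, 𝔼 x, f x y z w := by
  rw [Finset.expect_comm]
  refine (Finset.expect_congr rfl fun y _ => (Finset.expect_comm _ _ _).trans
    (Finset.expect_congr rfl fun z _ => Finset.expect_comm _ _ _)).trans ?_
  exact Finset.expect_comm _ _ _

theorem expect_last_first {α β γ δ : Type} [Fintype α] [Fintype β] [Fintype γ] [Fintype δ]
    (f : α → β → γ → δ → ℝ) :
    𝔼 x, 𝔼 y, 𝔼 z, 𝔼 w, f x y z w = 𝔼 w, 𝔼 x, 𝔼 y, 𝔼 z, f x y z w := by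
  rw [Finset.expect_comm (s := (Finset.univ : Finset δ))]
  refine Finset.expect_congr rfl fun x _ => ?_
  rw [Finset.expect_comm (s := (Finset.univ : Finset δ))]
  exact Finset.expect_congr rfl fun y _ => Finset.expect_comm _ _ _

/-- A uniform function and its value at `r` may be sampled by choosing the value separately. -/
theorem expect_eq_expect_update {α β : Type} [Fintype α] [DecidableEq α] [Fintype β] [Nonempty β]
    (r : α) (f : (α → β) → β → ℝ) :
    𝔼 O : α → β, f O (O r) = 𝔼 O : α → β, 𝔼 z : β, f (Function.update O r z) z := by
  have h := expect_involution (α := (α → β) × β)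
    (σ := fun p => (Function.update p.1 r p.2, p.1 r)) (fun p => by simp)
    fun p => f (Function.update p.1 r p.2) p.2
  rw [← Finset.univ_product_univ, Finset.expect_product, Finset.expect_product] at h
  rw [← h]
  refine Finset.expect_congr rfl fun O _ => ?_
  simp

theorem expect_sqrt_le {α : Type} [Fintype α] [Nonempty α] {f : α → ℝ} (hf : ∀ x, 0 ≤ f x) :
    𝔼 x, Real.sqrt (f x) ≤ Real.sqrt (𝔼 x, f x) := by
  refine Real.le_sqrt_of_sq_le ?_
  have h := Finset.expect_mul_sq_le_sq_mul_sq Finset.univ (fun x => Real.sqrt (f x)) fun _ => 1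
  simpa [Real.sq_sqrt (hf _)] using h

theorem Bits.add_add_cancel {k : ℕ} (x y : Bits k) : (x.add y).add y = x := by
  funext i; simp [Bits.add]

theorem expect_add {k : ℕ} (c : Bits k) (f : Bits k → ℝ) : 𝔼 z : Bits k, f (z.add c) = 𝔼 z, f z :=
  expect_involution (σ := fun z : Bits k => z.add c) (fun z => z.add_add_cancel c) f

/-! ### Reduction to the weight of queries at the coins of the challenge -/

/-- A challenge ciphertext that is masked by a string independent of the oracle does not depend on
the selecting bit, so that this bit is guessed with probability one half. -/
theorem expect_prob_independent_mask {a pk r m : ℕ} (A : CPAAdversary a m pk m (r + m))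
    (O : Bits a → Bits m) (key : Bits pk) (y : Bits r) :
    𝔼 b : Bool, 𝔼 z : Bits m,
      A.prob O key (fun m₀ m₁ => Fin.append y (z.add (if b then m₁ else m₀))) b = 1 / 2 := by
  -- For measured messages, shifting the mask by the selected one makes the answer independent of
  -- the bit.
  have h1 : ∀ b : Bool, 𝔼 z : Bits m,
      A.prob O key (fun m₀ m₁ => Fin.append y (z.add (if b then m₁ else m₀))) b =
      𝔼 z : Bits m, A.prob O key (fun _ _ => Fin.append y z) b := fun b => by
    simp only [CPAAdversary.prob]
    rw [Finset.expect_sum_comm, Finset.expect_sum_comm]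
    refine Finset.sum_congr rfl fun m₀ _ => ?_
    rw [Finset.expect_sum_comm, Finset.expect_sum_comm]
    exact Finset.sum_congr rfl fun m₁ _ => expect_add (if b then m₁ else m₀) fun z =>
      (runOracle O A.after (State.xorAt (fun j => A.challenge (Sum.inr j)) (Fin.append y z)
        (State.project (fun j => A.challenge (Sum.inl j)) (Sum.elim m₀ m₁)
          (runOracle O A.before (ket (place A.input key)))))).prob fun z => z A.output = b
  -- For an answer that is independent of the bit, the probabilities of all outputs add up to one.
  have h2 : ∀ s, ∑ b : Bool, A.prob O key (fun _ _ => s) b = 1 := fun s => by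
    simp only [CPAAdversary.prob]
    rw [Finset.sum_comm]
    simp_rw [Finset.sum_comm (s := (Finset.univ : Finset Bool))]
    have h3 : ∀ ψ : State A.qubits, ∑ b : Bool, ψ.prob (fun z => z A.output = b) = ψ.normSq :=
      fun ψ => by
        simp only [State.prob, State.normSq]
        rw [Finset.sum_comm]
        simp
    simp only [h3, normSq_runOracle]
    have h4 : ∀ ψ : State A.qubits,
        (State.xorAt (fun j => A.challenge (Sum.inr j)) s ψ).normSq = ψ.normSq := fun ψ =>
      State.normSq_comp_involution (xorAt_xorAt _ s) ψ
    simp only [h4]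
    set φ := runOracle O A.before (ket (place A.input key))
    rw [← sum_sumElim (f := fun c =>
      (State.project (fun j => A.challenge (Sum.inl j)) c φ).normSq)]
    have h5 : φ.normSq = 1 := (normSq_runOracle O _ _).trans (normSq_ket _)
    rw [← h5]
    simp only [State.normSq, State.project]
    rw [Finset.sum_comm]
    refine Finset.sum_congr rfl fun z _ => ?_
    simp [apply_ite]
  simp only [h1]
  rw [Finset.expect_comm, ← Fintype.expect_const (ι := Bits m) (1 / 2 : ℝ)]
  refine Finset.expect_congr rfl fun z _ => ?_
  rw [Fintype.expect_eq_sum_div_card, h2]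
  simp

/-- The initial state of the adversary's circuit: the public key generated with the coins `ρ`, and
the image of `x`. -/
noncomputable def coreInput (F : InjectiveTDF) (n : ℕ) {a m ct : ℕ}
    (A : CPAAdversary a m (F.pkLen n) m ct) (ρ : Bits (F.coinLen n)) (x : Bits (F.domLen n)) :
    Bits (coreQubits A.qubits (F.rngLen n) m) :=
  join (place A.input (F.gen n ρ).2) (F.eval n (F.gen n ρ).2 x) fun _ => false

/-- The advantage is small if measuring a query of the adversary rarely yields the coins of the
challenge, in a game where the mask of the ciphertext is independent of the oracle. In the actual
game the mask `z` is the value of the oracle at the coins `x`: the oracle is reprogrammed to take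
the value `z` at `x`. -/
theorem abs_cpaProb_sub_half_le (F : InjectiveTDF) (m : ℕ → ℕ) (n : ℕ)
    (A : CPAAdversary (F.domLen n) (m n) (F.pkLen n) (m n) (F.rngLen n + m n)) {L : ℕ} {V : ℝ}
    (hL : ∀ b z, (coreCircuit A b z).length ≤ L)
    (hV : ∀ i < L, ∀ b z, (𝔼 ρ, 𝔼 x, 𝔼 O : Bits (F.domLen n) → Bits (m n),
      queryWeight O (coreCircuit A b z) (ket (coreInput F n A ρ x)) x i) ≤ V) :
    |(F.bellareRogaway m).cpaProb n A - 1 / 2| ≤ 4 * (L * Real.sqrt V) := by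
  let G : (Bits (F.domLen n) → Bits (m n)) → Bits (F.coinLen n) → Bool → Bits (F.domLen n) →
      Bits (m n) → ℝ := fun O ρ b x z =>
    A.prob O (F.gen n ρ).2 (fun m₀ m₁ =>
      Fin.append (F.eval n (F.gen n ρ).2 x) (z.add (if b then m₁ else m₀))) b
  have h1 : (F.bellareRogaway m).cpaProb n A = 𝔼 b, 𝔼 z, 𝔼 ρ, 𝔼 x, 𝔼 O,
      G (Function.update O x z) ρ b x z := by
    have e : (F.bellareRogaway m).cpaProb n A = 𝔼 O, 𝔼 ρ, 𝔼 b, 𝔼 x, G O ρ b x (O x) := rfl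
    rw [e, expect_reorder fun O ρ b x => G O ρ b x (O x)]
    refine Finset.expect_congr rfl fun b _ => ?_
    rw [← expect_last_first fun ρ x O z => G (Function.update O x z) ρ b x z]
    exact Finset.expect_congr rfl fun ρ _ => Finset.expect_congr rfl fun x _ =>
      expect_eq_expect_update x fun O z => G O ρ b x z
  -- Without the reprogramming, the bit is guessed with probability one half.
  have h2 : (1 / 2 : ℝ) = 𝔼 b, 𝔼 z, 𝔼 ρ, 𝔼 x, 𝔼 O, G O ρ b x z := by
    have e : ∀ b, (𝔼 z, 𝔼 ρ, 𝔼 x, 𝔼 O, G O ρ b x z) = 𝔼 ρ, 𝔼 x, 𝔼 O, 𝔼 z, G O ρ b x z :=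
      fun b => (expect_last_first fun ρ x O z => G O ρ b x z).symm
    simp only [e]
    rw [← expect_last_first fun ρ x O b => 𝔼 z, G O ρ b x z]
    simp only [G, expect_prob_independent_mask, Fintype.expect_const]
  have h3 : ∀ O ρ b x z, |G (Function.update O x z) ρ b x z - G O ρ b x z| ≤
      4 * ∑ i ∈ Finset.range L,
        Real.sqrt (queryWeight O (coreCircuit A b z) (ket (coreInput F n A ρ x)) x i) := by
    intro O ρ b x z
    simp only [G, prob_coreCircuit A b z]
    refine (abs_prob_runOracle_sub_le (r := x) (fun x' hx => Function.update_of_ne hx _ _)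
      (coreCircuit A b z) (normSq_ket _) _).trans ?_
    refine mul_le_mul_of_nonneg_left ?_ (by norm_num)
    exact Finset.sum_le_sum_of_subset_of_nonneg (Finset.range_subset_range.2 (hL b z))
      fun _ _ _ => Real.sqrt_nonneg _
  have habs : ∀ {α : Type} [Fintype α] (f g : α → ℝ) {c : α → ℝ}, (∀ x, |f x - g x| ≤ c x) →
      |𝔼 x, f x - 𝔼 x, g x| ≤ 𝔼 x, c x := fun f g c h => by
    rw [← Finset.expect_sub_distrib]
    exact (Finset.abs_expect_le _ _).trans (Finset.expect_le_expect fun x _ => h x)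
  rw [h1, h2]
  refine (habs _ _ fun b => habs _ _ fun z => habs _ _ fun ρ => habs _ _ fun x => habs _ _
    fun O => h3 O ρ b x z).trans ?_
  refine Finset.expect_le Finset.univ_nonempty fun b _ =>
    Finset.expect_le Finset.univ_nonempty fun z _ => ?_
  simp only [← Finset.mul_expect, Finset.expect_sum_comm]
  refine mul_le_mul_of_nonneg_left ?_ (by norm_num)
  have hW := fun O ρ x => queryWeight_nonneg O (coreCircuit A b z) (ket (coreInput F n A ρ x)) x
  refine (Finset.sum_le_sum (g := fun _ => Real.sqrt V) fun i hi => ?_).trans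
    (by simp)
  refine le_trans ?_ (Real.sqrt_le_sqrt (hV i (Finset.mem_range.1 hi) b z))
  refine (Finset.expect_le_expect fun ρ _ => (Finset.expect_le_expect fun x _ =>
    expect_sqrt_le fun O => hW O ρ x i).trans (expect_sqrt_le fun x =>
      Finset.expect_nonneg fun O _ => hW O ρ x i)).trans (expect_sqrt_le fun ρ =>
        Finset.expect_nonneg fun x _ => Finset.expect_nonneg fun O _ => hW O ρ x i)

/-! ### Oracles with other input and output lengths -/

/-- A string, continued by zeros. -/
def Bits.pad {a : ℕ} (N : ℕ) (x : Bits a) : Bits N := fun j =>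
  if h : (j : ℕ) < a then x ⟨j, h⟩ else false

/-- The function on shorter strings that pads its argument and truncates the value. -/
def truncOracle {a b N : ℕ} (hb : b ≤ N) (O : Bits N → Bits N) : Bits a → Bits b :=
  fun x j => O (x.pad N) (Fin.castLE hb j)

theorem pad_injective {a N : ℕ} (ha : a ≤ N) : Function.Injective (Bits.pad (a := a) N) :=
  fun x y h => by
    funext j
    have := congrFun h (Fin.castLE ha j)
    simpa [Bits.pad] using this

/-- A uniform function remains uniform after padding the argument and truncating the value. -/
theorem expect_truncOracle {a b N : ℕ} (ha : a ≤ N) (hb : b ≤ N) (f : (Bits a → Bits b) → ℝ) :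
    𝔼 O : Bits N → Bits N, f (truncOracle hb O) = 𝔼 O, f O := by
  -- Shifting by functions whose truncations are all functions randomizes the truncation.
  let sec : (Bits a → Bits b) → Bits N → Bits N := fun O =>
    Function.extend (Bits.pad N) (fun x => (O x).pad N) fun _ _ => false
  let shift : (Bits a → Bits b) → (Bits N → Bits N) → Bits N → Bits N := fun O O' x =>
    (O' x).add (sec O x)
  have hshift : ∀ O O', truncOracle hb (shift O O') = fun x => (O x).add (truncOracle hb O' x) := by
    intro O O'
    funext x j
    simp only [truncOracle, shift, sec, (pad_injective ha).extend_apply, Bits.add]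
    simp [Bits.pad, Bool.xor_comm]
  have h1 : ∀ O : Bits a → Bits b, 𝔼 O' : Bits N → Bits N, f (truncOracle hb O') =
      𝔼 O' : Bits N → Bits N, f (fun x => (O x).add (truncOracle hb O' x)) := fun O => by
    rw [← expect_involution (σ := shift O) (fun O' => funext fun x => (O' x).add_add_cancel _)]
    simp only [hshift]
  have h2 : ∀ O' : Bits N → Bits N,
      𝔼 O : Bits a → Bits b, f (fun x => (O x).add (truncOracle hb O' x)) = 𝔼 O, f O := fun O' =>
    expect_involution (σ := fun (O : Bits a → Bits b) x => (O x).add (truncOracle hb O' x))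
      (fun O => funext fun x => (O x).add_add_cancel _) f
  rw [← Fintype.expect_const (ι := Bits a → Bits b) (𝔼 O' : Bits N → Bits N, f (truncOracle hb O')),
    Finset.expect_congr rfl fun O _ => h1 O, Finset.expect_comm, Finset.expect_congr rfl
      fun O' _ => h2 O', Fintype.expect_const]

theorem truncOracle_apply_comp {k K a b N : ℕ} (e : Fin k ↪ Fin K) (β : Bits K) (hb : b ≤ N)
    (O : Bits N → Bits N) (w : Fin a ⊕ Fin b ↪ Fin k) (u : Bits k) :
    xorAt (fun j => e (w (Sum.inr j)))
        (fun j => O (Bits.pad N fun i => u (w (Sum.inl i))) (Fin.castLE hb j)) (overlay e β u) =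
      overlay e β (queryMap (truncOracle hb O) w u) := by
  rw [queryMap, overlay_xorAt]
  rfl

/-! ### Simulating the oracle by circuits for a keyed function -/

/-- The qubits of the inverter: those of the simulated circuit, two qubits for the constants, and
one qubit for each gate of the circuit of the keyed function. -/
abbrev KeyedWire (k s : ℕ) : Type := Fin k ⊕ (Bool ⊕ Fin s)

/-- The qubits of the simulated circuit among those of the inverter. -/
noncomputable def keyedEmb (k s : ℕ) : Fin k ↪ Fin (Fintype.card (KeyedWire k s)) :=
  Function.Embedding.inl.trans (Fintype.equivFin (KeyedWire k s)).toEmbedding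

/-- The content of the additional qubits of the inverter. -/
noncomputable def keyedBackground (k s : ℕ) : Bits (Fintype.card (KeyedWire k s)) := fun q =>
  Sum.elim (fun _ => false) (Sum.elim id fun _ => false) ((Fintype.equivFin (KeyedWire k s)).symm q)

theorem overlay_keyed {k s : ℕ} (u : Bits k) (q : KeyedWire k s) :
    overlay (keyedEmb k s) (keyedBackground k s) u (Fintype.equivFin (KeyedWire k s) q) =
      Sum.elim u (Sum.elim id fun _ => false) q := by
  obtain j | q := q
  · exact overlay_apply _ _ u j
  · rw [overlay_of_ne _ _ _ fun i => by simp [keyedEmb]]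
    simp [keyedBackground]

/-- A query to the truncation of a keyed function is simulated by a circuit without oracle that has
the key hardwired. -/
theorem exists_keyed_simulation {k a b N : ℕ} (P : BoolCircuit N (N + N)) (hb : b ≤ N)
    (key : Bits N) (w : Fin a ⊕ Fin b ↪ Fin k) :
    ∃ L : List (Gate (Fintype.card (KeyedWire k P.size))), L.length ≤ 40 * (4 * P.size + b) ∧
      ∀ u, run L (ket (overlay (keyedEmb k P.size) (keyedBackground k P.size) u)) =
        ket (overlay (keyedEmb k P.size) (keyedBackground k P.size)
          (queryMap (truncOracle hb fun x => P.eval (Fin.append key x)) w u)) := by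
  let E := Fintype.equivFin (KeyedWire k P.size)
  -- The key is read from the two constant qubits, and so is the padding of the argument.
  let arg : Fin N → KeyedWire k P.size := fun j =>
    if h : (j : ℕ) < a then Sum.inl (w (Sum.inl ⟨j, h⟩)) else Sum.inr (Sum.inl false)
  let p : Fin (N + N) → KeyedWire k P.size := Fin.append (fun j => Sum.inr (Sum.inl (key j))) arg
  have hp : ∀ i, (∃ l, p i = Sum.inl (w (Sum.inl l))) ∨ ∃ v, p i = Sum.inr (Sum.inl v) :=
      fun i => by
    refine Fin.addCases (fun j => ?_) (fun j => ?_) i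
    · exact Or.inr ⟨key j, Fin.append_left _ _ _⟩
    · simp only [p, Fin.append_right, arg]
      split_ifs with h
      · exact Or.inl ⟨⟨j, h⟩, rfl⟩
      · exact Or.inr ⟨false, rfl⟩
  obtain ⟨L, hL, h⟩ := P.exists_classicalCircuit (fun i => E (p i))
    (fun j => E (Sum.inr (Sum.inr j)))
    (fun i j e => by simpa using e) (fun i j e => by
      obtain ⟨l, hl⟩ | ⟨l, hl⟩ := hp i <;> simp [hl] at e) (Fin.castLE hb)
    (fun j => E (Sum.inl (w (Sum.inr j)))) (fun i j e => by simpa using e)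
    (fun i j e => by obtain ⟨l, hl⟩ | ⟨l, hl⟩ := hp i <;> simp [hl] at e)
    (fun i j e => by simp at e)
  refine ⟨quantumGates L, ?_, fun u => ?_⟩
  · have := length_quantumGates L
    rw [Fintype.card_fin] at hL
    omega
  · rw [run_quantumGates_ket, h _ fun i => by rw [overlay_keyed]; rfl,
      ← truncOracle_apply_comp]
    have harg : (fun i => overlay (keyedEmb k P.size) (keyedBackground k P.size) u (E (p i))) =
        Fin.append key (Bits.pad N fun i => u (w (Sum.inl i))) := by
      funext i
      rw [overlay_keyed]
      refine Fin.addCases (fun j => ?_) (fun j => ?_) i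
      · simp [p]
      · simp only [p, Fin.append_right, arg, Bits.pad]
        split_ifs <;> simp
    rw [harg]
    rfl

theorem place_apply {k : ℕ} {ι : Type} [Fintype ι] {w : ι → Fin k} (hw : Function.Injective w)
    (s : ι → Bool) (j : ι) : place w s (w j) = s j := by
  rw [place, xorAt_apply hw, Bool.false_xor]

theorem place_of_ne {k : ℕ} {ι : Type} [Fintype ι] {w : ι → Fin k} (s : ι → Bool) {q : Fin k}
    (hq : ∀ j, w j ≠ q) : place w s q = false :=
  xorAt_apply_of_ne s _ hq

/-- Measuring a query of the adversary, run with a keyed function in place of the oracle, is an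
inversion algorithm. -/
theorem exists_inverter (F : InjectiveTDF) (n : ℕ) {m ct N : ℕ}
    (A : CPAAdversary (F.domLen n) m (F.pkLen n) m ct)
    (C : List (OracleGate (coreQubits A.qubits (F.rngLen n) m) (F.domLen n) m)) (i : ℕ)
    (P : BoolCircuit N (N + N)) (hb : m ≤ N) (key : Bits N) :
    ∃ B : QAlg (F.pkLen n + F.rngLen n) (F.domLen n),
      B.size ≤ F.domLen n + F.pkLen n + coreQubits A.qubits (F.rngLen n) m + F.rngLen n + P.size +
        42 + C.length * (40 * (4 * P.size + m) + 1) ∧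
      (𝔼 ρ, 𝔼 x, queryWeight (truncOracle hb fun x => P.eval (Fin.append key x)) C
        (ket (coreInput F n A ρ x)) x i) ≤ F.invProb n B := by
  let k := coreQubits A.qubits (F.rngLen n) m
  let O : Bits (F.domLen n) → Bits m := truncOracle hb fun x => P.eval (Fin.append key x)
  by_cases hi : ∃ w, C[i]? = some (.query w)
  · obtain ⟨w, hw⟩ := hi
    choose sim hsim_len hsim using exists_keyed_simulation (k := k) (a := F.domLen n) P hb key
    let E := Fintype.equivFin (KeyedWire k P.size)
    let e := keyedEmb k P.size
    have hin : Function.Injective (Fin.append (fun j => e (ownWire (F.rngLen n) m (A.input j)))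
        fun j => e (imageWire A.qubits m j)) := by
      rw [Fin.append_injective_iff]
      refine ⟨fun i j h => by simpa using h, fun i j h => by simpa using h, fun i j h => ?_⟩
      exact own_ne_image _ _ (e.injective h)
    let B : QAlg (F.pkLen n + F.rngLen n) (F.domLen n) :=
      { qubits := Fintype.card (KeyedWire k P.size)
        input := ⟨_, hin⟩
        output := (Function.Embedding.inl.trans w).trans e
        circuit := quantumGates [.not (E (Sum.inr (Sum.inl true)))] ++
          substQueries e id sim (C.take i) }
    refine ⟨B, ?_, ?_⟩
    · have h1 := length_substQueries e id sim (C.take i) hsim_len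
      have h2 := length_quantumGates [ClassicalGate.not (E (Sum.inr (Sum.inl true)))]
      have h3 : (C.take i).length * (40 * (4 * P.size + m) + 1) ≤
          C.length * (40 * (4 * P.size + m) + 1) :=
        Nat.mul_le_mul_right _ (List.length_take_le' _ _)
      have h4 : Fintype.card (KeyedWire k P.size) =
          coreQubits A.qubits (F.rngLen n) m + (2 + P.size) := by
        rw [Fintype.card_sum, Fintype.card_fin, Fintype.card_sum, Fintype.card_bool,
          Fintype.card_fin]
      simp only [QAlg.size, B, List.length_append, List.length_singleton] at h2 ⊢
      omega
    · refine Finset.expect_le_expect fun ρ _ => Finset.expect_le_expect fun x _ => ?_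
      -- The initial state of the inverter encodes the input of the adversary's circuit.
      have hstart : actList [ClassicalGate.not (E (Sum.inr (Sum.inl true)))]
          (place B.input (Fin.append (F.gen n ρ).2 (F.eval n (F.gen n ρ).2 x))) =
          overlay e (keyedBackground k P.size) (coreInput F n A ρ x) := by
        have hB1 : ∀ l, B.input (Fin.castAdd _ l) =
            E (Sum.inl (ownWire (F.rngLen n) m (A.input l))) :=
          fun l => Fin.append_left (fun j => e (ownWire (F.rngLen n) m (A.input j)))
            (fun j => e (imageWire A.qubits m j)) l
        have hB2 : ∀ l, B.input (Fin.natAdd _ l) = E (Sum.inl (imageWire A.qubits m l)) :=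
          fun l => Fin.append_right (fun j => e (ownWire (F.rngLen n) m (A.input j)))
            (fun j => e (imageWire A.qubits m j)) l
        funext q
        obtain ⟨q, rfl⟩ := E.surjective q
        rw [overlay_keyed]
        obtain q | v | q := q
        · have hne : E (Sum.inl q) ≠ E (Sum.inr (Sum.inl true)) := by simp
          rw [actList_cons, ClassicalGate.act]
          change Function.update _ _ _ _ = _
          rw [Function.update_of_ne hne]
          change _ = coreInput F n A ρ x q
          induction q using wire_cases with | h1 j | h2 j | h3 j
          · rw [coreInput, join_ownWire]
            by_cases hj : ∃ l, A.input l = j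
            · obtain ⟨l, rfl⟩ := hj
              rw [← hB1, place_apply B.input.injective, Fin.append_left,
                place_apply A.input.injective]
            · push Not at hj
              rw [place_of_ne _ hj, place_of_ne]
              refine fun l => Fin.addCases (fun l => ?_) (fun l => ?_) l
              · simpa [hB1] using hj l
              · simpa [hB2] using (own_ne_image j l).symm
          · rw [coreInput, join_imageWire, ← hB2, place_apply B.input.injective, Fin.append_right]
          · rw [coreInput, join_copyWire, place_of_ne]
            refine fun l => Fin.addCases (fun l => ?_) (fun l => ?_) l
            · simpa [hB1] using own_ne_copy _ _
            · simpa [hB2] using image_ne_copy _ _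
        · have h0 : place B.input (Fin.append (F.gen n ρ).2 (F.eval n (F.gen n ρ).2 x))
              (E (Sum.inr (Sum.inl v))) = false := by
            refine place_of_ne _ fun l => Fin.addCases (fun l => ?_) (fun l => ?_) l
            · simp [hB1]
            · simp [hB2]
          cases v
          · have hne : E (Sum.inr (Sum.inl false)) ≠ E (Sum.inr (Sum.inl true)) := by simp
            exact (Function.update_of_ne hne _ _).trans h0
          · exact (Function.update_self _ _ _).trans (by rw [h0]; rfl)
        · have h0 : place B.input (Fin.append (F.gen n ρ).2 (F.eval n (F.gen n ρ).2 x))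
              (E (Sum.inr (Sum.inr q))) = false := by
            refine place_of_ne _ fun l => Fin.addCases (fun l => ?_) (fun l => ?_) l
            · simp [hB1]
            · simp [hB2]
          have hne : E (Sum.inr (Sum.inr q)) ≠ E (Sum.inr (Sum.inl true)) := by simp
          exact (Function.update_of_ne hne _ _).trans h0
      rw [QAlg.prob, run_append, run_quantumGates_ket, hstart, ← lift_ket]
      have := foldl_substQueries (act := Gate.apply) Gate.isLinearMap (basic := id) (fun _ => rfl)
        O e (keyedBackground k P.size) hsim (C.take i) (ket (coreInput F n A ρ x))
      rw [run, this, prob_lift, queryWeight, hw]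
      -- If the query register reads `x`, then it reads a preimage of the image of `x`.
      refine Finset.sum_le_sum fun z _ => ?_
      have hout : (fun j => overlay e (keyedBackground k P.size) z (B.output j)) =
          fun j => z (w (Sum.inl j)) := funext fun j => overlay_apply _ _ _ _
      beta_reduce
      rw [hout]
      split_ifs with h1 h2 h2
      · exact le_rfl
      · exact absurd (by rw [h1]) h2
      · positivity
      · exact le_rfl
  -- If the gate is not a query, the weight is zero and every algorithm will do.
  · refine ⟨⟨F.pkLen n + F.rngLen n + F.domLen n, Fin.castAddEmb _, Fin.natAddEmb _, []⟩, ?_, ?_⟩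
    · simp [QAlg.size]; omega
    · refine Finset.expect_le_expect fun ρ _ => Finset.expect_le_expect fun x _ => ?_
      refine le_trans (le_of_eq ?_) (State.prob_nonneg _ _)
      rw [queryWeight]
      split
      · exact absurd ⟨_, ‹_›⟩ hi
      · rfl

/-! ### A distinguisher that tests a query -/

/-- The qubits of the distinguisher: those of the simulated circuit, the padding and the answer of
an oracle query, the output, and one qubit for each gate of the equality test. -/
abbrev TestWire (k N s : ℕ) : Type := Fin k ⊕ ((Fin N ⊕ Fin N) ⊕ (Unit ⊕ Fin s))

/-- The qubits of the simulated circuit among those of the distinguisher. -/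
noncomputable def testEmb (k N s : ℕ) : Fin k ↪ Fin (Fintype.card (TestWire k N s)) :=
  Function.Embedding.inl.trans (Fintype.equivFin (TestWire k N s)).toEmbedding

theorem overlay_test {k N s : ℕ} (u : Bits k) (q : TestWire k N s) :
    overlay (testEmb k N s) (fun _ => false) u (Fintype.equivFin (TestWire k N s) q) =
      Sum.elim u (fun _ => false) q := by
  obtain j | q := q
  · exact overlay_apply _ _ u j
  · exact overlay_of_ne _ _ _ fun i => by simp [testEmb]

theorem xorAt_comm {k : ℕ} {ι κ : Type} [Fintype ι] [Fintype κ] (w : ι → Fin k) (s : ι → Bool)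
    (v : κ → Fin k) (t : κ → Bool) (z : Bits k) :
    xorAt w s (xorAt v t z) = xorAt v t (xorAt w s z) := by
  funext q
  simp only [xorAt, Bool.xor_assoc]
  rw [Bool.xor_comm (decide _)]

/-- A query to the truncation of `O` is simulated by two queries to `O`. -/
theorem exists_query_simulation {k a b N s : ℕ} (hb : b ≤ N) (w : Fin a ⊕ Fin b ↪ Fin k) :
    ∃ L : List (OracleGate (Fintype.card (TestWire k N s)) N N), L.length ≤ 40 * b + 2 ∧
      ∀ (O : Bits N → Bits N) u, runOracle O L (ket (overlay (testEmb k N s) (fun _ => false) u)) =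
        ket (overlay (testEmb k N s) (fun _ => false) (queryMap (truncOracle hb O) w u)) := by
  let E := Fintype.equivFin (TestWire k N s)
  let arg : Fin N → TestWire k N s := fun j =>
    if h : (j : ℕ) < a then Sum.inl (w (Sum.inl ⟨j, h⟩)) else Sum.inr (Sum.inl (Sum.inl j))
  have harg : Function.Injective arg := fun i j h => by
    simp only [arg] at h
    split_ifs at h <;> simp_all [Fin.ext_iff]
  have harg_ne : ∀ i j, arg i ≠ Sum.inr (Sum.inl (Sum.inr j)) := fun i j h => by
    simp only [arg] at h
    split_ifs at h
    simp at h
  have harg_ne' : ∀ i j, arg i ≠ Sum.inl (w (Sum.inr j)) := fun i j h => by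
    simp only [arg] at h
    split_ifs at h
    simp at h
  let ans : Fin N → Fin (Fintype.card (TestWire k N s)) := fun j =>
    E (Sum.inr (Sum.inl (Sum.inr j)))
  let W : Fin N ⊕ Fin N ↪ Fin (Fintype.card (TestWire k N s)) :=
    ⟨Sum.elim (fun j => E (arg j)) ans, (E.injective.comp harg).sumElim
      (fun i j h => by simpa [ans] using h) fun i j h => harg_ne i j (E.injective h)⟩
  let t : Fin b → Fin (Fintype.card (TestWire k N s)) := fun j => E (Sum.inl (w (Sum.inr j)))
  have ht : Function.Injective t := fun i j h => by simpa [t] using h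
  have hans : Function.Injective ans := fun i j h => by simpa [ans] using h
  have hct : ∀ (i : Fin b) (j : Fin b), ans (Fin.castLE hb i) ≠ t j := fun i j h => by
    simp [ans, t] at h
  -- Query, copy the first bits of the answer, and query again to clear the answer register.
  refine ⟨.query W :: ((quantumGates (cnots (fun j => ans (Fin.castLE hb j)) t hct)).map .basic ++
    [.query W]), ?_, fun O u => ?_⟩
  · have h1 := length_quantumGates (cnots (fun j => ans (Fin.castLE hb j)) t hct)
    rw [length_cnots, Fintype.card_fin] at h1
    simp only [List.length_cons, List.length_append, List.length_map, List.length_nil]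
    omega
  · set Z := overlay (testEmb k N s) (fun _ => false) u with hZ
    have hx : (fun i => Z (W (Sum.inl i))) = Bits.pad N fun i => u (w (Sum.inl i)) := by
      funext j
      change Z (E (arg j)) = _
      rw [hZ, overlay_test]
      simp only [arg, Bits.pad]
      split_ifs <;> rfl
    set v := O (Bits.pad N fun i => u (w (Sum.inl i))) with hv
    have h1 : queryMap O W Z = xorAt ans v Z := by
      rw [queryMap, hx]; rfl
    have h2 : (fun j => xorAt ans v Z (ans (Fin.castLE hb j))) = fun j => v (Fin.castLE hb j) := by
      funext j
      rw [xorAt_apply hans, hZ, overlay_test, Sum.elim_inr, Bool.false_xor]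
    have h3 : queryMap O W (xorAt t (fun j => v (Fin.castLE hb j)) (xorAt ans v Z)) =
        xorAt t (fun j => v (Fin.castLE hb j)) Z := by
      have hx' : (fun i => xorAt t (fun j => v (Fin.castLE hb j)) (xorAt ans v Z) (W (Sum.inl i))) =
          Bits.pad N fun i => u (w (Sum.inl i)) := by
        rw [← hx]
        funext i
        rw [xorAt_apply_of_ne, xorAt_apply_of_ne]
        · exact fun j h => harg_ne i j (E.injective h).symm
        · exact fun j h => harg_ne' i j (E.injective h).symm
      rw [queryMap, hx', xorAt_comm t]
      exact xorAt_xorAt _ _ _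
    rw [runOracle_cons, OracleGate.apply_query_ket, h1, runOracle_append, runOracle_basic,
      run_quantumGates_ket, actList_cnots ht, h2, runOracle_cons, OracleGate.apply_query_ket, h3,
      ← truncOracle_apply_comp]
    rfl

/-- The weight of a query can be measured with quantum access to an oracle with longer inputs and
outputs. -/
theorem exists_distinguisher {k a b N : ℕ} (hb : b ≤ N) (C : List (OracleGate k a b)) (z₀ : Bits k)
    (r : Bits a) (i : ℕ) :
    ∃ D : Distinguisher N N,
      D.size ≤ 41 * k + 2 * N + 700 * a + 300 + C.length * (40 * b + 3) ∧
      ∀ O, D.prob O = queryWeight (truncOracle hb O) C (ket z₀) r i := by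
  by_cases hi : ∃ w, C[i]? = some (.query w)
  · obtain ⟨w, hw⟩ := hi
    set s := (eqTest r).size with hs
    rw [size_eqTest] at hs
    let E := Fintype.equivFin (TestWire k N s)
    let e := testEmb k N s
    choose sim hsim_len hsim using exists_query_simulation (k := k) (a := a) (s := s) hb
    let out := E (Sum.inr (Sum.inr (Sum.inl ())))
    obtain ⟨T, hT_len, hT⟩ := (eqTest r).exists_classicalCircuit
      (fun j => E (Sum.inl (w (Sum.inl j)))) (fun j => E (Sum.inr (Sum.inr (Sum.inr j))))
      (fun i j h => by simpa using h) (fun i j h => by simp at h) (fun _ : Unit => 0)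
      (fun _ => out) (fun _ _ _ => rfl) (fun i j h => by simp [out] at h)
      (fun i j h => by simp [out] at h)
    let D : Distinguisher N N :=
      { qubits := Fintype.card (TestWire k N s)
        output := out
        circuit := (quantumGates (nots e z₀)).map .basic ++
          (substQueries e .basic sim (C.take i) ++ (quantumGates T).map .basic) }
    refine ⟨D, ?_, fun O => ?_⟩
    · have h1 := length_substQueries e OracleGate.basic sim (C.take i) hsim_len
      have h2 := length_quantumGates (nots e z₀)
      have h3 : (C.take i).length * (40 * b + 2 + 1) ≤ C.length * (40 * b + 2 + 1) :=
        Nat.mul_le_mul_right _ (List.length_take_le' _ _)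
      rw [show 40 * b + 2 + 1 = 40 * b + 3 from rfl] at h1 h3
      have h4 : Fintype.card (TestWire k N s) = k + ((N + N) + (1 + s)) := by simp
      have h5 := length_quantumGates T
      have h6 := length_nots e z₀
      rw [Fintype.card_fin] at h6
      rw [Fintype.card_unit] at hT_len
      simp only [Distinguisher.size, D, List.length_append, List.length_map]
      omega
    · have hstart : actList (nots e z₀) (fun _ => false) = overlay e (fun _ => false) z₀ := by
        rw [actList_nots e.injective]
        funext q
        by_cases hq : ∃ j, e j = q
        · obtain ⟨j, rfl⟩ := hq
          rw [xorAt_apply e.injective, overlay_apply, Bool.false_xor]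
        · push Not at hq
          rw [xorAt_apply_of_ne _ _ hq, overlay_of_ne _ _ _ hq]
      have hsub := foldl_substQueries (act := OracleGate.apply O) (OracleGate.isLinearMap O)
        (basic := .basic) (fun _ => rfl) (truncOracle hb O) e (fun _ => false)
        (fun w z => hsim w O z) (C.take i) (ket z₀)
      rw [Distinguisher.prob, runOracle_append, runOracle_basic, run_quantumGates_ket, hstart,
        runOracle_append, runOracle_basic, ← lift_ket]
      have hT' : ∀ u, actList T (overlay e (fun _ => false) u) = xorAt (fun _ : Unit => out)
          (fun _ => (eqTest r).eval (fun j => u (w (Sum.inl j))) 0)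
          (overlay e (fun _ => false) u) := fun u => by
        have harg : (fun j => overlay e (fun _ => false) u (E (Sum.inl (w (Sum.inl j))))) =
            fun j => u (w (Sum.inl j)) := funext fun j => overlay_apply _ _ _ _
        rw [hT _ fun j => overlay_test u _, harg]
      have hinj : Function.Injective fun u => actList T (overlay e (fun _ => false) u) :=
        fun u u' h => overlay_injective e (fun _ => false) <| by
          rw [← actList_reverse T (overlay e _ u), ← actList_reverse T (overlay e _ u')]
          exact congrArg _ h
      rw [show runOracle O (substQueries e .basic sim (C.take i)) _ = _ from hsub, lift_eq_sum,
        ← (run_isLinearMap _).mk'_apply, map_sum]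
      simp only [map_smul, IsLinearMap.mk'_apply, run_quantumGates_ket]
      rw [prob_sum_smul_ket hinj, queryWeight, hw]
      refine Finset.sum_congr rfl fun u _ => ?_
      have hout : actList T (overlay e (fun _ => false) u) out = true ↔
          (fun j => u (w (Sum.inl j))) = r := by
        rw [hT', xorAt_apply (fun _ _ _ => rfl) _ _ (),
          show overlay e (fun _ => false) u out = false from overlay_test u _, Bool.false_xor,
          eval_eqTest]
      simp only [D, hout]
  -- If the gate is not a query, the weight is zero, as is the output of the empty circuit.
  · refine ⟨⟨1, 0, []⟩, ?_, fun O => ?_⟩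
    · simp [Distinguisher.size]; omega
    · have h : queryWeight (truncOracle hb O) C (ket z₀) r i = 0 := by
        rw [queryWeight]
        split
        · exact absurd ⟨_, ‹_›⟩ hi
        · rfl
      rw [h, Distinguisher.prob, State.prob]
      refine Finset.sum_eq_zero fun z _ => ?_
      split_ifs with hz
      · have : z ≠ fun _ => false := fun e => by rw [e] at hz; simp at hz
        simp [runOracle, ket_apply, this]
      · rfl

/-! ### The reduction -/

/-- The advantage of `D` in distinguishing `F` with a uniform key from a uniform function. -/
noncomputable def Distinguisher.advantage {N : ℕ} (D : Distinguisher N N)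
    (F : Bits N → Bits N → Bits N) : ℝ :=
  |(𝔼 key : Bits N, D.prob (F key)) - 𝔼 O : Bits N → Bits N, D.prob O|

/-- The nonuniform reduction: the query number, the bit, the ciphertext mask and the key that serve
an inverter best are hardwired, and so are the coins of the key generation and of the encryption
that serve a distinguisher best. -/
theorem exists_reduction (F : InjectiveTDF) (m : ℕ → ℕ) (n : ℕ) {N : ℕ} (hd : F.domLen n ≤ N)
    (hm : m n ≤ N) (A : CPAAdversary (F.domLen n) (m n) (F.pkLen n) (m n) (F.rngLen n + m n))
    (P : BoolCircuit N (N + N)) {L : ℕ} (hL : ∀ b z, (coreCircuit A b z).length ≤ L) :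
    ∃ (B : QAlg (F.pkLen n + F.rngLen n) (F.domLen n)) (D : Distinguisher N N),
      B.size ≤ F.domLen n + F.pkLen n + coreQubits A.qubits (F.rngLen n) (m n) + F.rngLen n +
        P.size + 42 + L * (40 * (4 * P.size + m n) + 1) ∧
      D.size ≤ 41 * coreQubits A.qubits (F.rngLen n) (m n) + 2 * N + 700 * F.domLen n + 300 +
        L * (40 * m n + 3) ∧
      |(F.bellareRogaway m).cpaProb n A - 1 / 2| ≤ 4 * (L * Real.sqrt (F.invProb n B +
        D.advantage fun key x => P.eval (Fin.append key x))) := by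
  let PF : Bits N → Bits N → Bits N := fun key x => P.eval (Fin.append key x)
  -- The query number, the bit and the mask that maximize the weight of the query.
  obtain ⟨⟨i, b, z⟩, hmax⟩ := Finite.exists_max fun q : Fin (L + 1) × Bool × Bits (m n) =>
    𝔼 ρ, 𝔼 x, 𝔼 O : Bits (F.domLen n) → Bits (m n), queryWeight O (coreCircuit A q.2.1 q.2.2)
      (ket (coreInput F n A ρ x)) x q.1
  set C := coreCircuit A b z with hC
  choose D hD_size hD using fun ρ x => exists_distinguisher hm C (coreInput F n A ρ x) x i
  choose B hB_size hB using exists_inverter F n A C i P hm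
  obtain ⟨⟨ρ₀, x₀⟩, hDmax⟩ := Finite.exists_max fun q : Bits (F.coinLen n) × Bits (F.domLen n) =>
    (D q.1 q.2).advantage PF
  obtain ⟨key₀, hBmax⟩ := Finite.exists_max fun key => F.invProb n (B key)
  refine ⟨B key₀, D ρ₀ x₀, (hB_size key₀).trans ?_, (hD_size ρ₀ x₀).trans ?_,
    abs_cpaProb_sub_half_le F m n A hL fun j hj b' z' => ?_⟩
  · exact Nat.add_le_add_left (Nat.mul_le_mul_right _ (hL b z)) _
  · exact Nat.add_le_add_left (Nat.mul_le_mul_right _ (hL b z)) _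
  · refine (hmax ⟨⟨j, by omega⟩, b', z'⟩).trans ?_
    -- Replacing the random oracle by the keyed function costs the advantage of a distinguisher.
    have h1 : ∀ ρ x, (𝔼 O, queryWeight O C (ket (coreInput F n A ρ x)) x i) ≤
        (𝔼 key, queryWeight (truncOracle hm (PF key)) C (ket (coreInput F n A ρ x)) x i) +
          (D ρ₀ x₀).advantage PF := fun ρ x => by
      rw [← expect_truncOracle hd hm]
      have h := hDmax (ρ, x)
      have h' := neg_abs_le ((𝔼 key : Bits N, (D ρ x).prob (PF key)) -
        𝔼 O : Bits N → Bits N, (D ρ x).prob O)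
      simp only [hD] at h'
      simp only [Distinguisher.advantage, hD] at h ⊢
      linarith
    have h2 : (𝔼 ρ, 𝔼 x, 𝔼 key,
        queryWeight (truncOracle hm (PF key)) C (ket (coreInput F n A ρ x)) x i) ≤
          F.invProb n (B key₀) := by
      have e : (𝔼 ρ, 𝔼 x, 𝔼 key,
          queryWeight (truncOracle hm (PF key)) C (ket (coreInput F n A ρ x)) x i) =
          𝔼 key, 𝔼 ρ, 𝔼 x,
          queryWeight (truncOracle hm (PF key)) C (ket (coreInput F n A ρ x)) x i := by
        rw [Finset.expect_comm (s := (Finset.univ : Finset (Bits N)))]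
        exact Finset.expect_congr rfl fun ρ _ => Finset.expect_comm _ _ _
      rw [e]
      exact Finset.expect_le Finset.univ_nonempty fun key _ => (hB key).trans (hBmax key)
    refine (Finset.expect_le_expect fun ρ _ => Finset.expect_le_expect fun x _ => h1 ρ x).trans ?_
    simp only [Finset.expect_add_distrib, Fintype.expect_const]
    exact add_le_add_left h2 _

/-! ### Polynomial bounds and negligible functions -/

theorem Polynomial.eval_monotone (p : Polynomial ℕ) : Monotone fun n => p.eval n := by
  induction p using Polynomial.induction_on' with
  | add p q hp hq => simpa using hp.add hq
  | monomial k c =>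
    intro a b h
    simp only [Polynomial.eval_monomial]
    exact Nat.mul_le_mul_left _ (Nat.pow_le_pow_left h _)

theorem PolyBounded.of_le {s t : ℕ → ℕ} (ht : PolyBounded t) (h : ∀ n, s n ≤ t n) :
    PolyBounded s := by
  obtain ⟨p, hp⟩ := ht
  exact ⟨p, fun n => (h n).trans (hp n)⟩

theorem PolyBounded.add {s t : ℕ → ℕ} (hs : PolyBounded s) (ht : PolyBounded t) :
    PolyBounded fun n => s n + t n := by
  obtain ⟨p, hp⟩ := hs
  obtain ⟨q, hq⟩ := ht
  exact ⟨p + q, fun n => by rw [Polynomial.eval_add]; exact Nat.add_le_add (hp n) (hq n)⟩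

theorem PolyBounded.mul {s t : ℕ → ℕ} (hs : PolyBounded s) (ht : PolyBounded t) :
    PolyBounded fun n => s n * t n := by
  obtain ⟨p, hp⟩ := hs
  obtain ⟨q, hq⟩ := ht
  exact ⟨p * q, fun n => by rw [Polynomial.eval_mul]; exact Nat.mul_le_mul (hp n) (hq n)⟩

theorem PolyBounded.const (c : ℕ) : PolyBounded fun _ => c :=
  ⟨Polynomial.C c, fun n => by simp⟩

theorem PolyBounded.id : PolyBounded fun n => n := ⟨Polynomial.X, fun n => by simp⟩

theorem PolyBounded.comp {s t : ℕ → ℕ} (hs : PolyBounded s) (ht : PolyBounded t) :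
    PolyBounded fun n => s (t n) := by
  obtain ⟨p, hp⟩ := hs
  obtain ⟨q, hq⟩ := ht
  refine ⟨p.comp q, fun n => (hp _).trans ?_⟩
  rw [Polynomial.eval_comp]
  exact Polynomial.eval_monotone p (hq n)

theorem Negligible.comp {ε : ℕ → ℝ} (h : Negligible ε) {N : ℕ → ℕ} (hN : ∀ n, n ≤ N n) :
    Negligible fun n => ε (N n) := by
  rw [Negligible, Asymptotics.superpolynomialDecay_iff_abs_tendsto_zero] at h ⊢
  intro k
  have hN' : Filter.Tendsto N Filter.atTop Filter.atTop :=
    Filter.tendsto_atTop_mono hN Filter.tendsto_id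
  refine squeeze_zero (fun n => abs_nonneg _) (fun n => ?_) ((h k).comp hN')
  simp only [Function.comp, abs_mul]
  refine mul_le_mul_of_nonneg_right ?_ (abs_nonneg _)
  rw [abs_of_nonneg (by positivity), abs_of_nonneg (by positivity)]
  exact pow_le_pow_left₀ (by positivity) (by exact_mod_cast hN n) k

theorem Negligible.sqrt {ε : ℕ → ℝ} (h : Negligible ε) :
    Negligible fun n => Real.sqrt (ε n) := fun k => by
  have h1 := (Real.continuous_sqrt.tendsto 0).comp (h (2 * k))
  rw [Real.sqrt_zero] at h1
  refine h1.congr fun n => ?_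
  rw [Function.comp, Real.sqrt_mul (by positivity), mul_comm 2 k, pow_mul,
    Real.sqrt_sq (by positivity)]

theorem Negligible.of_le_polyBounded_mul {ε δ : ℕ → ℝ} {L : ℕ → ℕ} (hε : Negligible ε)
    (hL : PolyBounded L) (h : ∀ n, |δ n| ≤ L n * |ε n|) : Negligible δ := by
  obtain ⟨p, hp⟩ := hL
  refine Asymptotics.SuperpolynomialDecay.trans_abs_le
    (Asymptotics.SuperpolynomialDecay.polynomial_mul hε (p.map (Nat.castRingHom ℝ))) fun n => ?_
  have e : (p.map (Nat.castRingHom ℝ)).eval (n : ℝ) = (p.eval n : ℕ) := by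
    simp
  simp only [e, abs_mul, Nat.abs_cast]
  exact (h n).trans (mul_le_mul_of_nonneg_right (by exact_mod_cast hp n) (abs_nonneg _))

end QROM

theorem mainTheorem3
    (hPRF : ∃ P : ∀ n : ℕ, QROM.Bits n → QROM.Bits n → QROM.Bits n, QROM.IsQuantumPRF P)
    (F : QROM.InjectiveTDF) (hF : F.QuantumImmune)
    (m : ℕ → ℕ) (hm : QROM.PolyBounded m) :
    (F.bellareRogaway m).QuantumCPASecure := by
  suffices h : ∀ A : ∀ n, QROM.CPAAdversary (F.domLen n) (m n) (F.pkLen n) (m n)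
      (F.rngLen n + m n), QROM.PolyBounded (fun n => (A n).size) →
      QROM.Negligible fun n => |(F.bellareRogaway m).cpaProb n (A n) - 1 / 2| from
    fun A hA => h A hA
  intro A hA
  obtain ⟨P, ⟨PC, hPC, hPsize⟩, hPsecure⟩ := hPRF
  obtain ⟨_, _, hE⟩ := F.eval_efficient
  have hs : QROM.PolyBounded fun n => (A n).size + F.pkLen n + F.domLen n + F.rngLen n + m n :=
    ((hA.add hE).add hm).of_le fun n => by dsimp only; omega
  obtain ⟨p, hp⟩ := hs
  -- The security parameter of the pseudorandom function: large enough for the lengths of the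
  -- random oracle, polynomial, and strictly increasing.
  let N : ℕ → ℕ := fun n => p.eval n + n
  have hN : StrictMono N := fun a b h =>
    Nat.add_lt_add_of_le_of_lt (QROM.Polynomial.eval_monotone p h.le) h
  have hNn : ∀ n, n ≤ N n := fun n => Nat.le_add_left _ _
  have hNs : ∀ n, (A n).size + F.pkLen n + F.domLen n + F.rngLen n + m n ≤ N n := fun n =>
    (hp n).trans (Nat.le_add_right _ _)
  have hNpoly : QROM.PolyBounded N := QROM.PolyBounded.add ⟨p, fun _ => le_rfl⟩ QROM.PolyBounded.id
  have hcore : ∀ n, QROM.coreQubits (A n).qubits (F.rngLen n) (m n) ≤ 2 * N n := fun n => by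
    have h1 := hNs n
    have h2 : (A n).qubits ≤ (A n).size := by rw [QROM.CPAAdversary.size]; omega
    simp only [QROM.coreQubits, Fintype.card_sum, Fintype.card_fin]
    omega
  have hL : ∀ n b z, (QROM.coreCircuit (A n) b z).length ≤ 160 * N n := fun n b z => by
    have h1 := QROM.length_coreCircuit (A n) b z
    have h2 := hNs n
    omega
  choose B D hB hD hadv using fun n => QROM.exists_reduction F m n (N := N n)
    (by have := hNs n; omega) (by have := hNs n; omega) (A n) (PC (N n)) (hL n)
  have hPC' : ∀ M, (fun key x => (PC M).eval (Fin.append key x)) = P M := fun M => by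
    funext key x
    rw [hPC]
    have h1 : QROM.Bits.left (Fin.append key x) = key := funext fun j => Fin.append_left key x j
    have h2 : QROM.Bits.right (Fin.append key x) = x := funext fun j => Fin.append_right key x j
    simp only [h1, h2]
  simp only [hPC'] at hadv
  have hPCN : QROM.PolyBounded fun n => (PC (N n)).size :=
    (hPsize.of_le (s := fun n => (PC n).size) fun n => by dsimp only; omega).comp hNpoly
  have hconst := QROM.PolyBounded.const
  -- The constants are crude bounds from `hB`, `hD` and `hNs`.
  have hBpoly : QROM.PolyBounded fun n => (B n).size := by
    refine QROM.PolyBounded.of_le ((((hconst 5).mul hNpoly).add (hPCN.add (hconst 42))).add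
      (((hconst 160).mul hNpoly).mul (((hconst 40).mul (((hconst 4).mul hPCN).add hNpoly)).add
        (hconst 1)))) fun n => ?_
    have h1 := hB n
    have h2 := hNs n
    have h3 := hcore n
    have h4 : 160 * N n * (40 * (4 * (PC (N n)).size + m n) + 1) ≤
        160 * N n * (40 * (4 * (PC (N n)).size + N n) + 1) := by gcongr; omega
    omega
  have hDpoly : QROM.PolyBounded fun n => (D n).size := by
    refine QROM.PolyBounded.of_le ((((hconst 784).mul hNpoly).add (hconst 300)).add
      (((hconst 160).mul hNpoly).mul (((hconst 40).mul hNpoly).add (hconst 3)))) fun n => ?_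
    have h1 := hD n
    have h2 := hNs n
    have h3 := hcore n
    have h4 : 160 * N n * (40 * m n + 3) ≤ 160 * N n * (40 * N n + 3) := by gcongr; omega
    omega
  -- As `N` is injective, the distinguishers form a family indexed by the values of `N`.
  obtain ⟨d, hd⟩ := hDpoly
  have hfamily : ∀ M, ∃ D' : QROM.Distinguisher M M, D'.size ≤ d.eval M + 1 ∧
      ∀ n, N n = M → D'.advantage (P M) = (D n).advantage (P (N n)) := fun M => by
    by_cases h : ∃ n, N n = M
    · obtain ⟨n, rfl⟩ := h
      refine ⟨D n, ((hd n).trans (QROM.Polynomial.eval_monotone d (hNn n))).trans (Nat.le_succ _),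
        fun n' hn' => ?_⟩
      rw [hN.injective hn']
    · exact ⟨⟨1, 0, []⟩, by simp [QROM.Distinguisher.size], fun n hn => absurd ⟨n, hn⟩ h⟩
  choose D' hD'_size hD' using hfamily
  have hD'neg : QROM.Negligible fun M => (D' M).advantage (P M) :=
    hPsecure D' ⟨d + 1, fun M => by simpa using hD'_size M⟩
  have hDneg : QROM.Negligible fun n => (D n).advantage (P (N n)) := by
    have h := hD'neg.comp hNn
    simp only [hD' _ _ rfl] at h
    exact h
  have hsum : QROM.Negligible fun n => F.invProb n (B n) + (D n).advantage (P (N n)) :=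
    Asymptotics.SuperpolynomialDecay.add (hF B hBpoly) hDneg
  refine hsum.sqrt.of_le_polyBounded_mul (((hconst 640).mul hNpoly)) fun n => ?_
  rw [abs_abs, abs_of_nonneg (Real.sqrt_nonneg _)]
  refine (hadv n).trans (le_of_eq ?_)
  push_cast
  ring
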